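/- Let $R$ be a commutative artinian ring, $\Lambda$ an artin $R$-algebra, $\mathrm{mod}\text{-}\Lambda$ the category of finitely generated right $\Lambda$-modules, and $n$ a positive integer. All subcategories are full. A subcategory $\mathcal C$ of $\mathrm{mod}\text{-}\Lambda$ is $n$-cluster tilting if it is functorially finite and $$\mathcal C=\{X\in \mathrm{mod}\text{-}\Lambda \mid \mathrm{Ext}^i_\Lambda(\mathcal C,X)=0,\ 0<i<n\}=\{X\in \mathrm{mod}\text{-}\Lambda\mid \mathrm{Ext}^i_\Lambda(X,\mathcal C)=0,\ 0<i<n\};$$ it is $n\mathbb Z$-cluster tilting if moreover $\mathrm{Ext}^i_\Lambda(\mathcal C,\mathcal C)=0$ for all $i\notin n\mathbb Z$. Let $\mathcal C$ be an $n\mathbb Z$-cluster tilting subcategory of $\mathrm{mod}\text{-}\Lambda$. An acyclic complex $P=(\cdots\to P^{-1}\to P^0\to P^1\to\cdots)$ of finitely generated projective modules, with cycles $Z^j=\mathrm{Ker}(P^j\to P^{j+1})$, is $n\mathbb Z$-totally acyclic if, for all $i\in\mathbb Z$, $Z^{in}\in\mathcal C$ and $\mathrm{Hom}_\Lambda(-,Q)$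 takes the exact sequence $$0\to Z^{in}\to P^{in}\to P^{in+1}\to\cdots\to P^{(i+1)n-1}\to Z^{(i+1)n}\to 0$$ to an exact sequence for every finitely generated projective module $Q$. A module $G\in\mathcal C$ is $n\mathbb Z$-Gorenstein projective if it is isomorphic to $Z^{in}$ for some $i\in\mathbb Z$ and some such complex $P$. Dually, $G\in\mathcal C$ is $n\mathbb Z$-Gorenstein injective if it is isomorphic to $Z^{in}$ for some $i\in\mathbb Z$ and some acyclic complex $I$ of finitely generated injective modules whose cycles $Z^{jn}$, $j\in\mathbb Z$, all lie in $\mathcal C$ and such that $\mathrm{Hom}_\Lambda(J,-)$ takes the corresponding sequences $0\to Z^{jn}\to I^{jn}\to\cdots\to I^{(j+1)n-1}\to Z^{(j+1)n}\to 0$ to exact sequences for every finitely generated injective module $J$. The subcategory $\mathcal C$ is called $n\mathbb Z$-Gorenstein cluster tilting if for every $C\in\mathcal C$ - there are an integer $i\ge 0$ and an exact sequence $0\to L\to P_{in-1}\to\cdots\to P_0\to C\to 0$ with all $P_j$ finitely generated projective (so $L$ is an $\Omega^{in}(C)$; $L\cong C$ if $i=0$) such that $L$ is $n\mathbb Z$-Gorenstein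 projective; and - there are an integer $i\ge 0$ and an exact sequence $0\to C\to I^0\to\cdots\to I^{in-1}\to L\to 0$ with all $I^j$ finitely generated injective (so $L$ is an $\Omega^{-in}(C)$; $L\cong C$ if $i=0$) such that $L$ is $n\mathbb Z$-Gorenstein injective. **Theorem.** Let $\mathcal C$ be an $n\mathbb Z$-cluster tilting subcategory of $\mathrm{mod}\text{-}\Lambda$. Then $\mathcal C$ is $n\mathbb Z$-Gorenstein cluster tilting if and only if $\Lambda$ is Iwanaga–Gorenstein, that is, $\Lambda$ has finite injective dimension both as a right and as a left module over itself. -/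

import Mathlib

open CategoryTheory

universe u

namespace GorensteinCT

variable {A : Type u} [Ring A]

/-- `C^{⊥ₙ}`: the finitely generated `X` with `Ext^i(C, X) = 0` for all `0 < i < n`. -/
def rightPerp (n : ℕ) (C : ObjectProperty (ModuleCat.{u} A)) : ObjectProperty (ModuleCat.{u} A) :=
  fun X => ModuleCat.isFG A X ∧
    ∀ M : ModuleCat.{u} A, C M → ∀ i : ℕ, 0 < i → i < n → Subsingleton (Abelian.Ext M X i)

/-- `^{⊥ₙ}C`: the finitely generated `X` with `Ext^i(X, C) = 0` for all `0 < i < n`. -/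
def leftPerp (n : ℕ) (C : ObjectProperty (ModuleCat.{u} A)) : ObjectProperty (ModuleCat.{u} A) :=
  fun X => ModuleCat.isFG A X ∧
    ∀ M : ModuleCat.{u} A, C M → ∀ i : ℕ, 0 < i → i < n → Subsingleton (Abelian.Ext X M i)

/-- Every finitely generated module has a right `C`-approximation and a left `C`-approximation. -/
structure IsFunctoriallyFinite (C : ObjectProperty (ModuleCat.{u} A)) : Prop where
  exists_right_approx (X : ModuleCat.{u} A) : ModuleCat.isFG A X →
    ∃ (M : ModuleCat.{u} A) (f : M ⟶ X), C M ∧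
      ∀ (M' : ModuleCat.{u} A) (g : M' ⟶ X), C M' → ∃ h : M' ⟶ M, h ≫ f = g
  exists_left_approx (X : ModuleCat.{u} A) : ModuleCat.isFG A X →
    ∃ (M : ModuleCat.{u} A) (f : X ⟶ M), C M ∧
      ∀ (M' : ModuleCat.{u} A) (g : X ⟶ M'), C M' → ∃ h : M ⟶ M', f ≫ h = g

/-- `n`-cluster tilting subcategories of the category of finitely generated `A`-modules. A full
subcategory is given by a property of objects; the two equations force it to consist of finitely
generated modules and to be closed under isomorphism. -/
structure IsClusterTilting (n : ℕ) (C : ObjectProperty (ModuleCat.{u} A)) : Prop where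
  functoriallyFinite : IsFunctoriallyFinite C
  eq_rightPerp : C = rightPerp n C
  eq_leftPerp : C = leftPerp n C

/-- `nℤ`-cluster tilting subcategories: `n`-cluster tilting with `Ext^i(C, C) = 0` for
all `i ∉ nℤ`. -/
structure IsZClusterTilting (n : ℕ) (C : ObjectProperty (ModuleCat.{u} A)) : Prop extends
    IsClusterTilting n C where
  ext_eq_zero (M N : ModuleCat.{u} A) : C M → C N → ∀ i : ℕ, ¬ n ∣ i →
    Subsingleton (Abelian.Ext M N i)

/-- For a complex `P` with cycles `Z^j = Ker (P^j ⟶ P^{j+1})`, acyclicity of `Hom(-, Q)` applied to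
`0 ⟶ Z^a ⟶ P^a ⟶ P^{a+1} ⟶ ⋯ ⟶ P^{b-1} ⟶ Z^b ⟶ 0` (where `a < b`), that is, exactness of
`0 ⟶ Hom(Z^b, Q) ⟶ Hom(P^{b-1}, Q) ⟶ ⋯ ⟶ Hom(P^a, Q) ⟶ Hom(Z^a, Q) ⟶ 0` at each term. -/
structure HomFromSegmentAcyclic (P : CochainComplex (ModuleCat.{u} A) ℤ) (a b : ℤ)
    (Q : ModuleCat.{u} A) : Prop where
  exact_left (h : P.cycles b ⟶ Q) : P.toCycles (b - 1) b ≫ h = 0 → h = 0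
  exact_middle (j : ℤ) (f : P.X j ⟶ Q) : a ≤ j → j < b →
    (j = a → P.iCycles j ≫ f = 0) → (a < j → P.d (j - 1) j ≫ f = 0) →
      (j + 1 = b → ∃ h : P.cycles (j + 1) ⟶ Q, P.toCycles j (j + 1) ≫ h = f) ∧
      (j + 1 < b → ∃ h : P.X (j + 1) ⟶ Q, P.d j (j + 1) ≫ h = f)
  exact_right (h : P.cycles a ⟶ Q) : ∃ g : P.X a ⟶ Q, P.iCycles a ≫ g = h

/-- For a complex `I` with cycles `Z^j = Ker (I^j ⟶ I^{j+1})`, acyclicity of `Hom(J, -)` applied to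
`0 ⟶ Z^a ⟶ I^a ⟶ I^{a+1} ⟶ ⋯ ⟶ I^{b-1} ⟶ Z^b ⟶ 0` (where `a < b`), that is, exactness of
`0 ⟶ Hom(J, Z^a) ⟶ Hom(J, I^a) ⟶ ⋯ ⟶ Hom(J, I^{b-1}) ⟶ Hom(J, Z^b) ⟶ 0` at each term. -/
structure HomToSegmentAcyclic (I : CochainComplex (ModuleCat.{u} A) ℤ) (a b : ℤ)
    (J : ModuleCat.{u} A) : Prop where
  exact_left (h : J ⟶ I.cycles a) : h ≫ I.iCycles a = 0 → h = 0
  exact_middle (j : ℤ) (f : J ⟶ I.X j) : a ≤ j → j < b →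
    (j + 1 = b → f ≫ I.toCycles j (j + 1) = 0) → (j + 1 < b → f ≫ I.d j (j + 1) = 0) →
      (j = a → ∃ h : J ⟶ I.cycles j, h ≫ I.iCycles j = f) ∧
      (a < j → ∃ h : J ⟶ I.X (j - 1), h ≫ I.d (j - 1) j = f)
  exact_right (h : J ⟶ I.cycles b) : ∃ g : J ⟶ I.X (b - 1), g ≫ I.toCycles (b - 1) b = h

/-- `nℤ`-totally acyclic complexes of finitely generated projective modules. -/
structure IsZTotallyAcyclic (n : ℕ) (C : ObjectProperty (ModuleCat.{u} A))
    (P : CochainComplex (ModuleCat.{u} A) ℤ) : Prop where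
  acyclic : P.Acyclic
  fg (j : ℤ) : ModuleCat.isFG A (P.X j)
  projective (j : ℤ) : Projective (P.X j)
  hom_acyclic (Q : ModuleCat.{u} A) : ModuleCat.isFG A Q → Projective Q →
    ∀ i : ℤ, HomFromSegmentAcyclic P (i * n) ((i + 1) * n) Q
  cycles_mem (i : ℤ) : C (P.cycles (i * n))

/-- The dual notion: `nℤ`-totally acyclic complexes of finitely generated injective modules. -/
structure IsZTotallyAcyclicInj (n : ℕ) (C : ObjectProperty (ModuleCat.{u} A))
    (I : CochainComplex (ModuleCat.{u} A) ℤ) : Prop where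
  acyclic : I.Acyclic
  fg (j : ℤ) : ModuleCat.isFG A (I.X j)
  injective (j : ℤ) : Injective (I.X j)
  hom_acyclic (J : ModuleCat.{u} A) : ModuleCat.isFG A J → Injective J →
    ∀ i : ℤ, HomToSegmentAcyclic I (i * n) ((i + 1) * n) J
  cycles_mem (i : ℤ) : C (I.cycles (i * n))

/-- `nℤ`-Gorenstein projective modules in `C`. -/
def IsZGorensteinProjective (n : ℕ) (C : ObjectProperty (ModuleCat.{u} A))
    (G : ModuleCat.{u} A) : Prop :=
  C G ∧ ∃ (P : CochainComplex (ModuleCat.{u} A) ℤ) (i : ℤ),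
    IsZTotallyAcyclic n C P ∧ Nonempty (G ≅ P.cycles (i * n))

/-- `nℤ`-Gorenstein injective modules in `C`. -/
def IsZGorensteinInjective (n : ℕ) (C : ObjectProperty (ModuleCat.{u} A))
    (G : ModuleCat.{u} A) : Prop :=
  C G ∧ ∃ (I : CochainComplex (ModuleCat.{u} A) ℤ) (i : ℤ),
    IsZTotallyAcyclicInj n C I ∧ Nonempty (G ≅ I.cycles (i * n))

/-- `L` is a `k`-th syzygy `Ω^k M`, i.e. there is an exact sequence
`0 ⟶ L ⟶ P_{k-1} ⟶ ⋯ ⟶ P_0 ⟶ M ⟶ 0` with `P_j` finitely generated projective, presented as a splice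
of short exact sequences. -/
def IsSyzygy : ℕ → ModuleCat.{u} A → ModuleCat.{u} A → Prop
  | 0, M, L => Nonempty (M ≅ L)
  | k + 1, M, L => ∃ (K P : ModuleCat.{u} A) (f : K ⟶ P) (g : P ⟶ M) (w : f ≫ g = 0),
      (ShortComplex.mk f g w).ShortExact ∧ ModuleCat.isFG A P ∧ Projective P ∧ IsSyzygy k K L

/-- `L` is a `k`-th cosyzygy `Ω^{-k} M`, i.e. there is an exact sequence
`0 ⟶ M ⟶ I^0 ⟶ ⋯ ⟶ I^{k-1} ⟶ L ⟶ 0` with `I^j` finitely generated injective, presented as a splice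
of short exact sequences. -/
def IsCosyzygy : ℕ → ModuleCat.{u} A → ModuleCat.{u} A → Prop
  | 0, M, L => Nonempty (M ≅ L)
  | k + 1, M, L => ∃ (I K : ModuleCat.{u} A) (f : M ⟶ I) (g : I ⟶ K) (w : f ≫ g = 0),
      (ShortComplex.mk f g w).ShortExact ∧ ModuleCat.isFG A I ∧ Injective I ∧ IsCosyzygy k K L

/-- For an `nℤ`-cluster tilting `C`: every object of `C` has some `Ω^{in}` that is
`nℤ`-Gorenstein projective. -/
def IsZGprjClusterTilting (n : ℕ) (C : ObjectProperty (ModuleCat.{u} A)) : Prop :=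
  ∀ M : ModuleCat.{u} A, C M → ∃ (i : ℕ) (L : ModuleCat.{u} A),
    IsSyzygy (i * n) M L ∧ IsZGorensteinProjective n C L

/-- For an `nℤ`-cluster tilting `C`: every object of `C` has some `Ω^{-in}` that is
`nℤ`-Gorenstein injective. -/
def IsZGinjClusterTilting (n : ℕ) (C : ObjectProperty (ModuleCat.{u} A)) : Prop :=
  ∀ M : ModuleCat.{u} A, C M → ∃ (i : ℕ) (L : ModuleCat.{u} A),
    IsCosyzygy (i * n) M L ∧ IsZGorensteinInjective n C L

/-- `nℤ`-Gorenstein cluster tilting subcategories. -/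
structure IsZGorensteinClusterTilting (n : ℕ) (C : ObjectProperty (ModuleCat.{u} A)) : Prop extends
    IsZClusterTilting n C where
  gprj : IsZGprjClusterTilting n C
  ginj : IsZGinjClusterTilting n C

/-- `Λ` has finite injective dimension as a right and as a left module over itself (right modules
over `Λ` are modules over `Λᵐᵒᵖ`). -/
structure IsIwanagaGorenstein (Λ : Type u) [Ring Λ] : Prop where
  right : injectiveDimension (ModuleCat.of Λᵐᵒᵖ Λ) < ⊤
  left : injectiveDimension (ModuleCat.of Λ Λ) < ⊤

end GorensteinCT

/-! Right `Λ`-modules are modules over `A = Λᵐᵒᵖ`; put `B = Λ`. Over a commutative artinian ring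
there is a finitely generated injective module `E` such that `D = Hom_R(-, E)` is a duality between
finitely generated `A`- and `B`-modules. Any `n`-cluster tilting `C` contains the projective module
`A` and the injective cogenerator `DB`, so the Gorenstein condition can be tested on these two.

Gorenstein implies finite dimension: let `L` be a `k`-th syzygy of an injective `J`, and let `L` be
a cycle `Z^z` of a totally acyclic complex `P`. All cycles satisfy `Ext^m(Z^j, Q) = 0` for `m > 0`
and `Q` finitely generated projective, so one may shift in both variables: `Ext^1(Z^{z+1}, L)`
vanishes with `Ext^{1+k}(Z^{z+1+k}, L)`, hence with `Ext^1(Z^{z+1+k}, J) = 0`. Thus `0 → Z^z → P^z →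
Z^{z+1} → 0` splits and `L` is projective (`IsZGorensteinProjective.projective_of_isSyzygy`). For `J
= DB` this bounds the projective dimension of `DB`, and by duality the injective dimension of `B`.
The dual argument on `A` bounds the injective dimension of `A`.

Conversely, if both injective dimensions are at most `d`, then `L = Ω^{dn} M` has no higher Ext into
projectives. Every finitely generated injective has finite projective dimension, which makes left
approximations of such modules by free modules monic (`exists_projAcyclic_cokernel`). Their
cokernels have the same Ext vanishing, so `L` acquires a complete resolution. Its cycles at
multiples of `n` stay in `C` because `C` is closed under `Ω^n` and because shifting both variables
by `n` preserves the Ext conditions (`IsZClusterTilting.cycles_mem_of_projAcyclic`). The injective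
side is dual. -/

namespace GorensteinCT

open Abelian

/-! ### Vanishing of Ext along short exact sequences. -/

section AbelianCategory

universe v w

variable {D : Type w} [Category.{v} D] [Abelian D] [HasExt.{v} D]

lemma subsingleton_ext_of_iso_left {X X' : D} (e : X ≅ X') {Y : D} {i : ℕ}
    (h : Subsingleton (Ext X Y i)) : Subsingleton (Ext X' Y i) := by
  refine subsingleton_of_forall_eq 0 fun x => ?_
  have : (Ext.mk₀ e.inv).comp ((Ext.mk₀ e.hom).comp x (zero_add i)) (zero_add i) = x := by
    simp [Ext.mk₀_comp_mk₀_assoc]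
  rw [← this, Subsingleton.elim ((Ext.mk₀ e.hom).comp x (zero_add i)) 0, Ext.comp_zero]

lemma subsingleton_ext_of_iso_right {X Y Y' : D} (e : Y ≅ Y') {i : ℕ}
    (h : Subsingleton (Ext X Y i)) : Subsingleton (Ext X Y' i) := by
  refine subsingleton_of_forall_eq 0 fun x => ?_
  have : (x.comp (Ext.mk₀ e.inv) (add_zero i)).comp (Ext.mk₀ e.hom) (add_zero i) = x := by
    rw [Ext.comp_assoc_of_third_deg_zero]
    simp [Ext.mk₀_comp_mk₀]
  rw [← this, Subsingleton.elim (x.comp (Ext.mk₀ e.inv) (add_zero i)) 0, Ext.zero_comp]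

lemma subsingleton_ext_iso_iff_left {X X' : D} (e : X ≅ X') {Y : D} {i : ℕ} :
    Subsingleton (Ext X Y i) ↔ Subsingleton (Ext X' Y i) :=
  ⟨subsingleton_ext_of_iso_left e, subsingleton_ext_of_iso_left e.symm⟩

lemma subsingleton_ext_iso_iff_right {X Y Y' : D} (e : Y ≅ Y') {i : ℕ} :
    Subsingleton (Ext X Y i) ↔ Subsingleton (Ext X Y' i) :=
  ⟨subsingleton_ext_of_iso_right e, subsingleton_ext_of_iso_right e.symm⟩

lemma subsingleton_ext_of_projective {P : D} [Projective P] (Y : D) {i : ℕ} (hi : 0 < i) :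
    Subsingleton (Ext P Y i) :=
  HasProjectiveDimensionLT.subsingleton P 1 i hi Y

lemma subsingleton_ext_of_injective {I : D} [Injective I] (X : D) {i : ℕ} (hi : 0 < i) :
    Subsingleton (Ext X I i) :=
  HasInjectiveDimensionLT.subsingleton I 1 i hi X

section

variable {S : ShortComplex D} (hS : S.ShortExact)
include hS

lemma subsingleton_ext_succ_X₃ {Y : D} {i : ℕ} (h₁ : Subsingleton (Ext S.X₁ Y i))
    (h₂ : Subsingleton (Ext S.X₂ Y (i + 1))) : Subsingleton (Ext S.X₃ Y (i + 1)) := by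
  refine subsingleton_of_forall_eq 0 fun x => ?_
  obtain ⟨y, rfl⟩ := Ext.contravariant_sequence_exact₃ hS Y x (Subsingleton.elim _ _)
    (add_comm 1 i)
  rw [Subsingleton.elim y 0, Ext.comp_zero]

lemma subsingleton_ext_X₁ {Y : D} {i : ℕ} (h₂ : Subsingleton (Ext S.X₂ Y i))
    (h₃ : Subsingleton (Ext S.X₃ Y (i + 1))) : Subsingleton (Ext S.X₁ Y i) := by
  refine subsingleton_of_forall_eq 0 fun x => ?_
  obtain ⟨y, rfl⟩ := Ext.contravariant_sequence_exact₁ hS Y x (add_comm 1 i)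
    (Subsingleton.elim _ _)
  rw [Subsingleton.elim y 0, Ext.comp_zero]

lemma subsingleton_ext_succ_X₁ {Y : D} {i : ℕ} (h₃ : Subsingleton (Ext Y S.X₃ i))
    (h₂ : Subsingleton (Ext Y S.X₂ (i + 1))) : Subsingleton (Ext Y S.X₁ (i + 1)) := by
  refine subsingleton_of_forall_eq 0 fun x => ?_
  obtain ⟨y, rfl⟩ := Ext.covariant_sequence_exact₁ Y hS x (Subsingleton.elim _ _) rfl
  rw [Subsingleton.elim y 0, Ext.zero_comp]

lemma subsingleton_ext_X₃ {Y : D} {i : ℕ} (h₂ : Subsingleton (Ext Y S.X₂ i))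
    (h₁ : Subsingleton (Ext Y S.X₁ (i + 1))) : Subsingleton (Ext Y S.X₃ i) := by
  refine subsingleton_of_forall_eq 0 fun x => ?_
  obtain ⟨y, rfl⟩ := Ext.covariant_sequence_exact₃ Y hS x rfl (Subsingleton.elim _ _)
  rw [Subsingleton.elim y 0, Ext.zero_comp]

lemma subsingleton_ext_contravariant_shift {Y : D}
    (h₂ : ∀ m, 0 < m → Subsingleton (Ext S.X₂ Y m)) {i : ℕ} (hi : 0 < i) :
    Subsingleton (Ext S.X₁ Y i) ↔ Subsingleton (Ext S.X₃ Y (i + 1)) :=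
  ⟨fun h => subsingleton_ext_succ_X₃ hS h (h₂ _ i.succ_pos),
    fun h => subsingleton_ext_X₁ hS (h₂ _ hi) h⟩

lemma subsingleton_ext_covariant_shift {Y : D}
    (h₂ : ∀ m, 0 < m → Subsingleton (Ext Y S.X₂ m)) {i : ℕ} (hi : 0 < i) :
    Subsingleton (Ext Y S.X₃ i) ↔ Subsingleton (Ext Y S.X₁ (i + 1)) :=
  ⟨fun h => subsingleton_ext_succ_X₁ hS h (h₂ _ i.succ_pos),
    fun h => subsingleton_ext_X₃ hS (h₂ _ hi) h⟩

lemma exists_extension_of_subsingleton_ext_one {Y : D} (h : Subsingleton (Ext S.X₃ Y 1))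
    (f : S.X₁ ⟶ Y) : ∃ g : S.X₂ ⟶ Y, S.f ≫ g = f := by
  obtain ⟨y, hy⟩ := Ext.contravariant_sequence_exact₁ hS Y (Ext.mk₀ f) (add_zero 1)
    (Subsingleton.elim _ _)
  obtain ⟨g, rfl⟩ := (Ext.mk₀_bijective _ _).2 y
  exact ⟨g, (Ext.mk₀_bijective _ _).1 (by simpa using hy)⟩

lemma exists_lift_of_subsingleton_ext_one {Y : D} (h : Subsingleton (Ext Y S.X₁ 1))
    (f : Y ⟶ S.X₃) : ∃ g : Y ⟶ S.X₂, g ≫ S.g = f := by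
  obtain ⟨y, hy⟩ := Ext.covariant_sequence_exact₃ Y hS (Ext.mk₀ f) (zero_add 1)
    (Subsingleton.elim _ _)
  obtain ⟨g, rfl⟩ := (Ext.mk₀_bijective _ _).2 y
  exact ⟨g, (Ext.mk₀_bijective _ _).1 (by simpa using hy)⟩

/-- Every class in `Ext^1(S.X₃, Y)` is the image of a map `S.X₁ ⟶ Y` under the connecting map, and
that image is zero once the map extends to `S.X₂`. -/
lemma subsingleton_ext_one_of_exists_extension {Y : D} (h₂ : Subsingleton (Ext S.X₂ Y 1))
    (h : ∀ f : S.X₁ ⟶ Y, ∃ g : S.X₂ ⟶ Y, S.f ≫ g = f) : Subsingleton (Ext S.X₃ Y 1) := by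
  refine subsingleton_of_forall_eq 0 fun x => ?_
  obtain ⟨y, rfl⟩ := Ext.contravariant_sequence_exact₃ hS Y x (Subsingleton.elim _ _)
    (add_zero 1)
  obtain ⟨f, rfl⟩ := (Ext.mk₀_bijective _ _).2 y
  obtain ⟨g, rfl⟩ := h f
  rw [← Ext.mk₀_comp_mk₀, hS.extClass_comp_assoc]

lemma subsingleton_ext_one_of_exists_lift {Y : D} (h₂ : Subsingleton (Ext Y S.X₂ 1))
    (h : ∀ f : Y ⟶ S.X₃, ∃ g : Y ⟶ S.X₂, g ≫ S.g = f) : Subsingleton (Ext Y S.X₁ 1) := by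
  refine subsingleton_of_forall_eq 0 fun x => ?_
  obtain ⟨y, rfl⟩ := Ext.covariant_sequence_exact₁ Y hS x (Subsingleton.elim _ _)
    (zero_add 1)
  obtain ⟨f, rfl⟩ := (Ext.mk₀_bijective _ _).2 y
  obtain ⟨g, rfl⟩ := h f
  rw [← Ext.mk₀_comp_mk₀, Ext.comp_assoc_of_second_deg_zero, hS.comp_extClass, Ext.comp_zero]

/-- The identity of `S.X₁` extends to `S.X₂`, so the sequence splits. -/
lemma projective_X₁_of_subsingleton_ext_one [Projective S.X₂]
    (h : Subsingleton (Ext S.X₃ S.X₁ 1)) : Projective S.X₁ := by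
  obtain ⟨r, hr⟩ := exists_extension_of_subsingleton_ext_one hS h (𝟙 _)
  exact (Retract.mk S.f r hr).projective

lemma injective_X₃_of_subsingleton_ext_one [Injective S.X₂]
    (h : Subsingleton (Ext S.X₃ S.X₁ 1)) : Injective S.X₃ := by
  obtain ⟨s, hs⟩ := exists_lift_of_subsingleton_ext_one hS h (𝟙 _)
  exact (Retract.mk s S.g hs).injective

end

end AbelianCategory

/-! ### Syzygies and dimension shifting. -/

variable {A : Type u} [Ring A]

/-- Modules `G` with `Ext^m(G, Q) = 0` for all `m > 0` and all finitely generated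
projective `Q`. -/
def ProjAcyclic (G : ModuleCat.{u} A) : Prop :=
  ∀ Q : ModuleCat.{u} A, ModuleCat.isFG A Q → Projective Q →
    ∀ m : ℕ, 0 < m → Subsingleton (Ext G Q m)

/-- Modules `G` with `Ext^m(J, G) = 0` for all `m > 0` and all finitely generated
injective `J`. -/
def InjAcyclic (G : ModuleCat.{u} A) : Prop :=
  ∀ J : ModuleCat.{u} A, ModuleCat.isFG A J → Injective J →
    ∀ m : ℕ, 0 < m → Subsingleton (Ext J G m)

lemma IsSyzygy.subsingleton_ext_iff (Y : ModuleCat.{u} A) :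
    ∀ {k : ℕ} {M L : ModuleCat.{u} A}, IsSyzygy k M L → ∀ {i : ℕ}, 0 < i →
      (Subsingleton (Ext L Y i) ↔ Subsingleton (Ext M Y (i + k)))
  | 0, _, _, ⟨e⟩, _, _ => (subsingleton_ext_iso_iff_left e).symm
  | k + 1, _, _, ⟨_, _, _, _, _, hS, _, _, h⟩, i, hi => by
    rw [h.subsingleton_ext_iff Y hi]
    exact subsingleton_ext_contravariant_shift hS
      (fun m hm => subsingleton_ext_of_projective Y hm) (Nat.add_pos_left hi k)

/-- Projective resolutions normally shift only the first variable of Ext. Here they shift the second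
one, because `Ext^m(G, P) = 0` for the projective middle terms `P`. -/
lemma IsSyzygy.subsingleton_ext_iff_of_projAcyclic {G : ModuleCat.{u} A} (hG : ProjAcyclic G) :
    ∀ {k : ℕ} {M L : ModuleCat.{u} A}, IsSyzygy k M L → ∀ {i : ℕ}, 0 < i →
      (Subsingleton (Ext G M i) ↔ Subsingleton (Ext G L (i + k)))
  | 0, _, _, ⟨e⟩, _, _ => subsingleton_ext_iso_iff_right e
  | k + 1, _, _, ⟨_, P, _, _, _, hS, hP, hP', h⟩, i, hi => by
    rw [← add_assoc, add_right_comm, ← h.subsingleton_ext_iff_of_projAcyclic hG i.succ_pos]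
    exact subsingleton_ext_covariant_shift hS (hG P hP hP') hi

lemma IsCosyzygy.subsingleton_ext_iff (Y : ModuleCat.{u} A) :
    ∀ {k : ℕ} {M L : ModuleCat.{u} A}, IsCosyzygy k M L → ∀ {i : ℕ}, 0 < i →
      (Subsingleton (Ext Y L i) ↔ Subsingleton (Ext Y M (i + k)))
  | 0, _, _, ⟨e⟩, _, _ => (subsingleton_ext_iso_iff_right e).symm
  | k + 1, _, _, ⟨_, _, _, _, _, hS, _, _, h⟩, i, hi => by
    rw [h.subsingleton_ext_iff Y hi]
    exact subsingleton_ext_covariant_shift hS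
      (fun m hm => subsingleton_ext_of_injective Y hm) (Nat.add_pos_left hi k)

lemma IsCosyzygy.subsingleton_ext_iff_of_injAcyclic {G : ModuleCat.{u} A} (hG : InjAcyclic G) :
    ∀ {k : ℕ} {M L : ModuleCat.{u} A}, IsCosyzygy k M L → ∀ {i : ℕ}, 0 < i →
      (Subsingleton (Ext M G i) ↔ Subsingleton (Ext L G (i + k)))
  | 0, _, _, ⟨e⟩, _, _ => subsingleton_ext_iso_iff_left e
  | k + 1, _, _, ⟨I, _, _, _, _, hS, hI, hI', h⟩, i, hi => by
    rw [← add_assoc, add_right_comm, ← h.subsingleton_ext_iff_of_injAcyclic hG i.succ_pos]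
    exact subsingleton_ext_contravariant_shift hS (hG I hI hI') hi

lemma isFG_of_iso {M N : ModuleCat.{u} A} (e : M ≅ N) (h : ModuleCat.isFG A M) :
    ModuleCat.isFG A N := by
  have : Module.Finite A M := h
  exact Module.Finite.equiv e.toLinearEquiv

lemma isFG_X₁ [IsNoetherianRing A] {S : ShortComplex (ModuleCat.{u} A)} (hS : S.ShortExact)
    (h : ModuleCat.isFG A S.X₂) : ModuleCat.isFG A S.X₁ := by
  have : Module.Finite A S.X₂ := h
  exact Module.Finite.of_injective S.f.hom ((ModuleCat.mono_iff_injective _).1 hS.mono_f)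

lemma isFG_X₃ {S : ShortComplex (ModuleCat.{u} A)} (hS : S.ShortExact)
    (h : ModuleCat.isFG A S.X₂) : ModuleCat.isFG A S.X₃ := by
  have : Module.Finite A S.X₂ := h
  exact Module.Finite.of_surjective S.g.hom ((ModuleCat.epi_iff_surjective _).1 hS.epi_g)

lemma IsSyzygy.isFG [IsNoetherianRing A] :
    ∀ {k : ℕ} {M L : ModuleCat.{u} A}, IsSyzygy k M L → ModuleCat.isFG A M → ModuleCat.isFG A L
  | 0, _, _, ⟨e⟩, h => isFG_of_iso e h
  | _ + 1, _, _, ⟨_, _, _, _, _, hS, hP, _, h⟩, _ => h.isFG (isFG_X₁ hS hP)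

lemma IsCosyzygy.isFG :
    ∀ {k : ℕ} {M L : ModuleCat.{u} A}, IsCosyzygy k M L → ModuleCat.isFG A M → ModuleCat.isFG A L
  | 0, _, _, ⟨e⟩, h => isFG_of_iso e h
  | _ + 1, _, _, ⟨_, _, _, _, _, hS, hP, _, h⟩, _ => h.isFG (isFG_X₃ hS hP)

lemma IsSyzygy.hasProjectiveDimensionLT :
    ∀ {k : ℕ} {M L : ModuleCat.{u} A}, IsSyzygy k M L → Projective L →
      HasProjectiveDimensionLT M (k + 1)
  | 0, _, _, ⟨e⟩, _ => hasProjectiveDimensionLT_of_iso e.symm 1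
  | k + 1, _, _, ⟨_, _, _, _, _, hS, _, hP, h⟩, hL => by
    have := h.hasProjectiveDimensionLT hL
    exact hS.hasProjectiveDimensionLT_X₃ (k + 1) this
      (hasProjectiveDimensionLT_of_ge _ 1 _ (by omega))

lemma IsCosyzygy.hasInjectiveDimensionLT :
    ∀ {k : ℕ} {M L : ModuleCat.{u} A}, IsCosyzygy k M L → Injective L →
      HasInjectiveDimensionLT M (k + 1)
  | 0, _, _, ⟨e⟩, _ => hasInjectiveDimensionLT_of_iso e.symm 1
  | k + 1, _, _, ⟨_, _, _, _, _, hS, _, hI, h⟩, hL => by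
    have := h.hasInjectiveDimensionLT hL
    exact hS.hasInjectiveDimensionLT_X₁ (k + 1) this
      (hasInjectiveDimensionLT_of_ge _ 1 _ (by omega))

/-! ### Closure properties of cluster tilting subcategories. -/

namespace IsClusterTilting

variable {n : ℕ} {C : ObjectProperty (ModuleCat.{u} A)} (hC : IsClusterTilting n C)
include hC

lemma isFG {X : ModuleCat.{u} A} (hX : C X) : ModuleCat.isFG A X := by
  rw [hC.eq_leftPerp] at hX
  exact hX.1

lemma mem_of_ext_left {X : ModuleCat.{u} A} (hX : ModuleCat.isFG A X)
    (h : ∀ M, C M → ∀ i : ℕ, 0 < i → i < n → Subsingleton (Ext X M i)) : C X := by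
  rw [hC.eq_leftPerp]
  exact ⟨hX, h⟩

lemma mem_of_ext_right {X : ModuleCat.{u} A} (hX : ModuleCat.isFG A X)
    (h : ∀ M, C M → ∀ i : ℕ, 0 < i → i < n → Subsingleton (Ext M X i)) : C X := by
  rw [hC.eq_rightPerp]
  exact ⟨hX, h⟩

lemma mem_of_projective {P : ModuleCat.{u} A} (hP : ModuleCat.isFG A P) [Projective P] : C P :=
  hC.mem_of_ext_left hP fun _ _ _ hi _ => subsingleton_ext_of_projective _ hi

lemma mem_of_injective {I : ModuleCat.{u} A} (hI : ModuleCat.isFG A I) [Injective I] : C I :=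
  hC.mem_of_ext_right hI fun _ _ _ hi _ => subsingleton_ext_of_injective _ hi

lemma ext_eq_zero_of_lt {X Y : ModuleCat.{u} A} (hX : C X) (hY : C Y) {i : ℕ} (hi : 0 < i)
    (hin : i < n) : Subsingleton (Ext X Y i) := by
  rw [hC.eq_leftPerp] at hX
  exact hX.2 Y hY i hi hin

lemma mem_of_iso {X Y : ModuleCat.{u} A} (e : X ≅ Y) (hX : C X) : C Y :=
  hC.mem_of_ext_left (isFG_of_iso e (hC.isFG hX)) fun _ hM _ hi hin =>
    subsingleton_ext_of_iso_left e (hC.ext_eq_zero_of_lt hX hM hi hin)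

end IsClusterTilting

namespace IsZClusterTilting

variable {n : ℕ} {C : ObjectProperty (ModuleCat.{u} A)} (hC : IsZClusterTilting n C)
include hC

/-- `Ext^i(Ω^n X, M)` vanishes with `Ext^{i+n}(X, M)`, and `i + n` is not a multiple of `n` when `0
< i < n`. -/
lemma mem_of_isSyzygy [IsNoetherianRing A] {X Y : ModuleCat.{u} A} (hX : C X)
    (h : IsSyzygy n X Y) : C Y :=
  hC.mem_of_ext_left (h.isFG (hC.isFG hX)) fun M hM _ hi hin =>
    (h.subsingleton_ext_iff M hi).2 <| hC.ext_eq_zero X M hX hM _ fun hd =>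
      (Nat.le_of_dvd hi ((Nat.dvd_add_left dvd_rfl).1 hd)).not_gt hin

lemma mem_of_isCosyzygy {X Y : ModuleCat.{u} A} (hX : C X) (h : IsCosyzygy n X Y) : C Y :=
  hC.mem_of_ext_right (h.isFG (hC.isFG hX)) fun M hM _ hi hin =>
    (h.subsingleton_ext_iff M hi).2 <| hC.ext_eq_zero M X hM hX _ fun hd =>
      (Nat.le_of_dvd hi ((Nat.dvd_add_left dvd_rfl).1 hd)).not_gt hin

end IsZClusterTilting

/-! ### Decomposition and existence of syzygies. -/

lemma IsSyzygy.exists_of_add : ∀ {k l : ℕ} {M L : ModuleCat.{u} A}, IsSyzygy (k + l) M L →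
    ∃ K, IsSyzygy k M K ∧ IsSyzygy l K L
  | 0, l, M, L, h => ⟨M, ⟨Iso.refl M⟩, by rwa [zero_add] at h⟩
  | k + 1, l, M, L, h => by
    rw [add_right_comm] at h
    obtain ⟨K, P, f, g, w, hS, hP, hP', h⟩ := h
    obtain ⟨K', h₁, h₂⟩ := h.exists_of_add
    exact ⟨K', ⟨K, P, f, g, w, hS, hP, hP', h₁⟩, h₂⟩

lemma IsCosyzygy.exists_of_add : ∀ {k l : ℕ} {M L : ModuleCat.{u} A}, IsCosyzygy (k + l) M L →
    ∃ K, IsCosyzygy k M K ∧ IsCosyzygy l K L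
  | 0, l, M, L, h => ⟨M, ⟨Iso.refl M⟩, by rwa [zero_add] at h⟩
  | k + 1, l, M, L, h => by
    rw [add_right_comm] at h
    obtain ⟨I, K, f, g, w, hS, hI, hI', h⟩ := h
    obtain ⟨K', h₁, h₂⟩ := h.exists_of_add
    exact ⟨K', ⟨I, K, f, g, w, hS, hI, hI', h₁⟩, h₂⟩

lemma exists_projective_presentation [IsNoetherianRing A] {M : ModuleCat.{u} A}
    (hM : ModuleCat.isFG A M) : ∃ (K P : ModuleCat.{u} A) (f : K ⟶ P) (g : P ⟶ M) (w : f ≫ g = 0),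
      (ShortComplex.mk f g w).ShortExact ∧ ModuleCat.isFG A P ∧ Projective P := by
  have : Module.Finite A M := hM
  obtain ⟨m, φ, hφ⟩ := Module.Finite.exists_fin' A M
  let P := ModuleCat.of A (Fin m → A)
  let g : P ⟶ M := ModuleCat.ofHom φ
  have : Epi g := (ModuleCat.epi_iff_surjective _).2 hφ
  refine ⟨Limits.kernel g, P, Limits.kernel.ι g, g, Limits.kernel.condition g,
    { exact := ShortComplex.exact_kernel g }, ?_, ?_⟩
  · exact inferInstanceAs (Module.Finite A (Fin m → A))
  · exact ModuleCat.projective_of_free (Pi.basisFun A (Fin m))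

lemma exists_isSyzygy [IsNoetherianRing A] (k : ℕ) :
    ∀ {M : ModuleCat.{u} A}, ModuleCat.isFG A M → ∃ L, IsSyzygy k M L := by
  induction k with
  | zero => exact fun {M} _ => ⟨M, ⟨Iso.refl M⟩⟩
  | succ k ih =>
    intro M hM
    obtain ⟨K, P, f, g, w, hS, hP, hP'⟩ := exists_projective_presentation hM
    obtain ⟨L, hL⟩ := ih (isFG_X₁ hS hP)
    exact ⟨L, K, P, f, g, w, hS, hP, hP', hL⟩

/-! ### Cycles of acyclic complexes and splicing. -/

section AbelianCategory

universe v w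

variable {D : Type w} [Category.{v} D] [Abelian D]

lemma epi_toCycles_of_acyclic {K : CochainComplex D ℤ} (hK : K.Acyclic) (j : ℤ) :
    Epi (K.toCycles j (j + 1)) :=
  Preadditive.epi_of_isZero_cokernel' _ (K.homologyIsCokernel j (j + 1) (by simp))
    (hK (j + 1)).isZero_homology

lemma iCycles_toCycles (K : CochainComplex D ℤ) (j : ℤ) :
    K.iCycles j ≫ K.toCycles j (j + 1) = 0 := by
  simp [← cancel_mono (K.iCycles (j + 1))]

lemma shortExact_cycles {K : CochainComplex D ℤ} (hK : K.Acyclic) (j : ℤ) :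
    (ShortComplex.mk (K.iCycles j) (K.toCycles j (j + 1)) (iCycles_toCycles K j)).ShortExact := by
  have := epi_toCycles_of_acyclic hK j
  refine { exact := ShortComplex.exact_of_f_is_kernel _ ?_ }
  exact Limits.isKernelOfComp _ _ (K.cyclesIsKernel j (j + 1) (by simp))
    (iCycles_toCycles K j) (K.toCycles_i j (j + 1))

/-- Exactness in the middle is insensitive to precomposing with an epimorphism and postcomposing
with a monomorphism. -/
lemma exact_splice {X₀ Z₁ X₁ Z₂ X₂ : D} (g₀ : X₀ ⟶ Z₁) (f₁ : Z₁ ⟶ X₁) (g₁ : X₁ ⟶ Z₂)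
    (f₂ : Z₂ ⟶ X₂) [Epi g₀] [Mono f₂] (w : f₁ ≫ g₁ = 0) (h : (ShortComplex.mk f₁ g₁ w).Exact)
    (w' : (g₀ ≫ f₁) ≫ g₁ ≫ f₂ = 0) : (ShortComplex.mk (g₀ ≫ f₁) (g₁ ≫ f₂) w').Exact := by
  have w'' : f₁ ≫ g₁ ≫ f₂ = 0 := by simp [reassoc_of% w]
  let φ₁ : ShortComplex.mk (g₀ ≫ f₁) (g₁ ≫ f₂) w' ⟶ ShortComplex.mk f₁ (g₁ ≫ f₂) w'' :=
    { τ₁ := g₀, τ₂ := 𝟙 _, τ₃ := 𝟙 _ }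
  let φ₂ : ShortComplex.mk f₁ g₁ w ⟶ ShortComplex.mk f₁ (g₁ ≫ f₂) w'' :=
    { τ₁ := 𝟙 _, τ₂ := 𝟙 _, τ₃ := f₂ }
  have : Epi φ₁.τ₁ := ‹Epi g₀›
  have : IsIso φ₁.τ₂ := inferInstanceAs (IsIso (𝟙 X₁))
  have : Mono φ₁.τ₃ := inferInstanceAs (Mono (𝟙 X₂))
  have : Epi φ₂.τ₁ := inferInstanceAs (Epi (𝟙 Z₁))
  have : IsIso φ₂.τ₂ := inferInstanceAs (IsIso (𝟙 X₁))
  have : Mono φ₂.τ₃ := ‹Mono f₂›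
  rw [ShortComplex.exact_iff_of_epi_of_isIso_of_mono φ₁,
    ← ShortComplex.exact_iff_of_epi_of_isIso_of_mono φ₂]
  exact h

/-- A doubly infinite family of composable short exact sequences is spliced into an acyclic
complex. -/
lemma exists_acyclic_of_shortExact (Z X : ℤ → D) (f : ∀ k, Z k ⟶ X k) (g : ∀ k, X k ⟶ Z (k + 1))
    (w : ∀ k, f k ≫ g k = 0) (hS : ∀ k, (ShortComplex.mk (f k) (g k) (w k)).ShortExact) :
    ∃ K : CochainComplex D ℤ, K.Acyclic ∧ (∀ k, K.X k = X k) ∧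
      ∀ k, Nonempty (K.cycles k ≅ Z k) := by
  have hd (k : ℤ) : (g k ≫ f (k + 1)) ≫ g (k + 1) ≫ f (k + 1 + 1) = 0 := by
    simp [reassoc_of% (w (k + 1))]
  let K : CochainComplex D ℤ := CochainComplex.of X (fun k => g k ≫ f (k + 1)) hd
  have hKd (k : ℤ) : K.d k (k + 1) = g k ≫ f (k + 1) :=
    CochainComplex.of_d X (fun k => g k ≫ f (k + 1)) k
  have hf (k : ℤ) : Mono (f k) := (hS k).mono_f
  have hg (k : ℤ) : Epi (g k) := (hS k).epi_g
  refine ⟨K, fun k => ?_, fun _ => rfl, fun k => ?_⟩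
  · obtain ⟨k, rfl⟩ : ∃ j, k = j + 1 := ⟨k - 1, by simp⟩
    rw [K.exactAt_iff' k (k + 1) (k + 1 + 1) (by simp) (by simp)]
    have := exact_splice (g k) (f (k + 1)) (g (k + 1)) (f (k + 1 + 1)) (w (k + 1))
      (hS (k + 1)).exact (hd k)
    convert this using 1
    simp only [HomologicalComplex.sc', HomologicalComplex.shortComplexFunctor', hKd]
  -- The kernel of `g k ≫ f (k + 1)` is that of `g k`, since `f (k + 1)` is monic.
  · have h₁ : Limits.IsLimit (Limits.KernelFork.ofι (f k) (w k)) := (hS k).fIsKernel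
    have h₂ := Limits.isKernelCompMono h₁ (f (k + 1)) (hKd k)
    exact ⟨(K.cyclesIsKernel k (k + 1) (by simp)).conePointUniqueUpToIso h₂⟩

end AbelianCategory

lemma exists_int_family {α : Type*} (r : α → α → Prop) (p : α → Prop)
    (up : ∀ x, p x → ∃ y, p y ∧ r x y) (down : ∀ x, p x → ∃ y, p y ∧ r y x) (x₀ : α)
    (h₀ : p x₀) : ∃ Z : ℤ → α, Z 0 = x₀ ∧ ∀ k, p (Z k) ∧ r (Z k) (Z (k + 1)) := by
  choose! u hup hur using up
  choose! d hdp hdr using down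
  have hu (k : ℕ) : p (u^[k] x₀) := by
    induction k with
    | zero => exact h₀
    | succ k ih => rw [Function.iterate_succ_apply']; exact hup _ ih
  have hd (k : ℕ) : p (d^[k] x₀) := by
    induction k with
    | zero => exact h₀
    | succ k ih => rw [Function.iterate_succ_apply']; exact hdp _ ih
  let Z : ℤ → α
    | .ofNat k => u^[k] x₀
    | .negSucc k => d^[k + 1] x₀
  refine ⟨Z, rfl, fun k => ?_⟩
  match k with
  | .ofNat k =>
    refine ⟨hu k, ?_⟩
    change r (u^[k] x₀) (u^[k + 1] x₀)
    rw [Function.iterate_succ_apply']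
    exact hur _ (hu k)
  | .negSucc k =>
    refine ⟨hd (k + 1), ?_⟩
    have : Z (.negSucc k + 1) = d^[k] x₀ := by
      cases k with
      | zero => rfl
      | succ k => rfl
    rw [this]
    change r (d^[k + 1] x₀) _
    rw [Function.iterate_succ_apply']
    exact hdr _ (hd k)

/-! ### Segment acyclicity as an extension or lifting property of cycles. -/

variable {A : Type u} [Ring A]

/-- A map on `P^j` killing `Z^j` factors through `Z^{j+1}`, and the extension property carries the
factor on to `P^{j+1}`. -/
lemma homFromSegmentAcyclic_of_extension {P : CochainComplex (ModuleCat.{u} A) ℤ}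
    (hP : P.Acyclic) {Q : ModuleCat.{u} A}
    (hQ : ∀ (j : ℤ) (h : P.cycles j ⟶ Q), ∃ g : P.X j ⟶ Q, P.iCycles j ≫ g = h) (a b : ℤ) :
    HomFromSegmentAcyclic P a b Q where
  exact_left h hh := by
    -- Reindexing replaces `b - 1 + 1`, which is not definitionally `b`, by a plain successor.
    generalize hc : b - 1 = c at hh
    obtain rfl : b = c + 1 := by omega
    have := epi_toCycles_of_acyclic hP c
    exact Limits.zero_of_epi_comp _ hh
  exact_middle j f haj _ h₁ h₂ := by
    have hf : P.iCycles j ≫ f = 0 := by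
      rcases haj.eq_or_lt with rfl | haj
      · exact h₁ rfl
      · have h₃ := h₂ haj
        generalize hc : j - 1 = c at h₃
        obtain rfl : j = c + 1 := by omega
        have := epi_toCycles_of_acyclic hP c
        rw [← P.toCycles_i, Category.assoc] at h₃
        exact Limits.zero_of_epi_comp _ h₃
    obtain ⟨h, hh⟩ : ∃ h : P.cycles (j + 1) ⟶ Q, P.toCycles j (j + 1) ≫ h = f :=
      have := (shortExact_cycles hP j).epi_g
      ⟨(shortExact_cycles hP j).exact.desc f hf, (shortExact_cycles hP j).exact.g_desc f hf⟩
    refine ⟨fun _ => ⟨h, hh⟩, fun _ => ?_⟩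
    obtain ⟨g, rfl⟩ := hQ (j + 1) h
    exact ⟨g, by rw [← hh, ← P.toCycles_i, Category.assoc]⟩
  exact_right := hQ a

lemma homToSegmentAcyclic_of_lift {I : CochainComplex (ModuleCat.{u} A) ℤ}
    (hI : I.Acyclic) {J : ModuleCat.{u} A}
    (hJ : ∀ (j : ℤ) (h : J ⟶ I.cycles (j + 1)), ∃ g : J ⟶ I.X j, g ≫ I.toCycles j (j + 1) = h)
    (a b : ℤ) : HomToSegmentAcyclic I a b J where
  exact_left h hh := Limits.zero_of_comp_mono (I.iCycles a) hh
  exact_middle j f _ hjb h₁ h₂ := by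
    have hf : f ≫ I.toCycles j (j + 1) = 0 := by
      rcases (Int.add_one_le_iff.2 hjb).eq_or_lt with h | h
      · exact h₁ h
      · rw [← cancel_mono (I.iCycles (j + 1)), Category.assoc, I.toCycles_i, h₂ h,
          Limits.zero_comp]
    obtain ⟨h, hh⟩ : ∃ h : J ⟶ I.cycles j, h ≫ I.iCycles j = f :=
      have := (shortExact_cycles hI j).mono_f
      ⟨(shortExact_cycles hI j).exact.lift f hf, (shortExact_cycles hI j).exact.lift_f f hf⟩
    refine ⟨fun _ => ⟨h, hh⟩, fun _ => ?_⟩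
    generalize hc : j - 1 = c
    obtain rfl : j = c + 1 := by omega
    obtain ⟨g, rfl⟩ := hJ c h
    exact ⟨g, by rw [← hh, ← I.toCycles_i, Category.assoc]⟩
  exact_right h := by
    generalize hc : b - 1 = c
    obtain rfl : b = c + 1 := by omega
    exact hJ c h

lemma exists_mul_le_lt {n : ℕ} (hn : 0 < n) (j : ℤ) : ∃ i : ℤ, i * n ≤ j ∧ j < (i + 1) * n := by
  have hn' : (0 : ℤ) < n := by exact_mod_cast hn
  refine ⟨j / n, Int.ediv_mul_le j hn'.ne', ?_⟩
  exact Int.lt_mul_of_ediv_lt hn' (lt_add_one _)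

/-- At a multiple of `n` this is exactness at the left end of a segment. At any other index, the
composite `P^{j-1} → Z^j → Q` kills the incoming differential or cycle, so exactness at `P^{j-1}`
factors it through `P^j`. -/
lemma exists_extension_of_homFromSegmentAcyclic {P : CochainComplex (ModuleCat.{u} A) ℤ}
    (hP : P.Acyclic) {Q : ModuleCat.{u} A} {n : ℕ} (hn : 0 < n)
    (h : ∀ i : ℤ, HomFromSegmentAcyclic P (i * n) ((i + 1) * n) Q) (j : ℤ) (f : P.cycles j ⟶ Q) :
    ∃ g : P.X j ⟶ Q, P.iCycles j ≫ g = f := by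
  obtain ⟨i, hi, hi'⟩ := exists_mul_le_lt hn j
  rcases hi.eq_or_lt with rfl | hi
  · exact (h i).exact_right f
  · obtain ⟨j, rfl⟩ : ∃ c, j = c + 1 := ⟨j - 1, by simp⟩
    have := epi_toCycles_of_acyclic hP j
    obtain ⟨g, hg⟩ := ((h i).exact_middle j (P.toCycles j (j + 1) ≫ f) (by omega) (by omega)
      (fun _ => by rw [← Category.assoc, iCycles_toCycles, Limits.zero_comp])
      (fun _ => by simp)).2 hi'
    exact ⟨g, by rwa [← P.toCycles_i, Category.assoc, cancel_epi] at hg⟩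

lemma exists_lift_of_homToSegmentAcyclic {I : CochainComplex (ModuleCat.{u} A) ℤ}
    {J : ModuleCat.{u} A} {n : ℕ} (hn : 0 < n)
    (h : ∀ i : ℤ, HomToSegmentAcyclic I (i * n) ((i + 1) * n) J) (j : ℤ)
    (f : J ⟶ I.cycles (j + 1)) : ∃ g : J ⟶ I.X j, g ≫ I.toCycles j (j + 1) = f := by
  obtain ⟨i, hi, hi'⟩ := exists_mul_le_lt hn j
  rcases (Int.add_one_le_iff.2 hi').eq_or_lt with hj | hj
  · have := (h i).exact_right
    rw [← hj] at this
    generalize hc : j + 1 - 1 = c at this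
    obtain rfl : c = j := by omega
    exact this f
  · have hg := ((h i).exact_middle (j + 1) (f ≫ I.iCycles (j + 1)) (by omega) hj
      (fun _ => by rw [Category.assoc, iCycles_toCycles, Limits.comp_zero])
      (fun _ => by simp)).2 (by omega)
    generalize hc : j + 1 - 1 = c at hg
    obtain rfl : c = j := by omega
    obtain ⟨g, hg⟩ := hg
    exact ⟨g, by rwa [← I.toCycles_i, ← Category.assoc, cancel_mono] at hg⟩

/-! ### The dualizing module of a commutative artinian ring. -/

section Matlis

variable {R : Type u} [CommRing R]

/-- Induction along a composition series: `Hom(-, X)` is left exact and each simple factor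
contributes at most one to the length. -/
lemma length_linearMap_le_length {X M : Type u} [AddCommGroup X] [Module R X] [AddCommGroup M]
    [Module R M]
    (hX : ∀ (k : Type u) [AddCommGroup k] [Module R k], IsSimpleModule R k →
      Module.length R (k →ₗ[R] X) ≤ 1)
    (hM : IsFiniteLength R M) : Module.length R (M →ₗ[R] X) ≤ Module.length R M := by
  induction hM with
  | of_subsingleton => simp [Module.length_eq_zero]
  | @of_simple_quotient M _ _ N hN _ ih =>
    let f : ((M ⧸ N) →ₗ[R] X) →ₗ[R] (M →ₗ[R] X) := LinearMap.lcomp R X N.mkQ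
    let g : (M →ₗ[R] X) →ₗ[R] (N →ₗ[R] X) := LinearMap.lcomp R X N.subtype
    have hf : Function.Injective f := fun a b h => by
      refine LinearMap.ext fun x => ?_
      obtain ⟨x, rfl⟩ := N.mkQ_surjective x
      exact LinearMap.congr_fun h x
    have hfg : Function.Exact f g.rangeRestrict := by
      intro φ
      rw [← LinearMap.mem_ker, LinearMap.ker_rangeRestrict, LinearMap.mem_ker]
      refine ⟨fun h => ?_, ?_⟩
      · have hφ : N ≤ LinearMap.ker φ := fun x hx => LinearMap.congr_fun h ⟨x, hx⟩
        exact ⟨N.liftQ φ hφ, N.liftQ_mkQ φ hφ⟩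
      · rintro ⟨ψ, rfl⟩
        ext x
        have : (Submodule.Quotient.mk (x : M) : M ⧸ N) = 0 :=
          (Submodule.Quotient.mk_eq_zero N).2 x.2
        simp [f, g, this]
    rw [Module.length_eq_add_of_exact f g.rangeRestrict hf g.surjective_rangeRestrict hfg,
      Module.length_eq_add_of_exact N.subtype N.mkQ N.subtype_injective N.mkQ_surjective
        (LinearMap.exact_subtype_mkQ N), add_comm]
    refine add_le_add
      ((Module.length_le_of_injective _ (LinearMap.range g).subtype_injective).trans ih) ?_
    rw [Module.length_eq_one R (M ⧸ N)]
    exact hX _ hN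

variable (R) in
/-- The product of all simple modules, one from each isomorphism class. -/
abbrev SimpleProduct : Type u := ∀ m : MaximalSpectrum R, R ⧸ m.asIdeal

lemma exists_injective_to_simpleProduct (k : Type u) [AddCommGroup k] [Module R k]
    (hk : IsSimpleModule R k) :
    ∃ f : k →ₗ[R] SimpleProduct R, Function.Injective f := by
  classical
  obtain ⟨I, hI, ⟨e⟩⟩ := isSimpleModule_iff_quot_maximal.1 hk
  exact ⟨LinearMap.single R (fun m : MaximalSpectrum R => R ⧸ m.asIdeal) ⟨I, hI⟩ ∘ₗ e.toLinearMap,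
    (Pi.single_injective (M := fun m : MaximalSpectrum R => R ⧸ m.asIdeal) ⟨I, hI⟩).comp
      e.injective⟩

/-- For `k ≅ R ⧸ I` only the `I`-component of a map can be nonzero: some `a ∈ I` outside another
maximal ideal `m` kills `k` but acts injectively on `R ⧸ m`. -/
lemma length_linearMap_simpleProduct_le_one (k : Type u) [AddCommGroup k] [Module R k]
    (hk : IsSimpleModule R k) : Module.length R (k →ₗ[R] SimpleProduct R) ≤ 1 := by
  obtain ⟨I, hI, ⟨e⟩⟩ := isSimpleModule_iff_quot_maximal.1 hk
  let φ : (k →ₗ[R] SimpleProduct R) →ₗ[R] R ⧸ I :=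
    LinearMap.proj (φ := fun m : MaximalSpectrum R => R ⧸ m.asIdeal) ⟨I, hI⟩ ∘ₗ
      LinearMap.applyₗ (e.symm 1)
  have hφ : Function.Injective φ := by
    rw [← LinearMap.ker_eq_bot, LinearMap.ker_eq_bot']
    intro f hf
    have h : f (e.symm 1) = 0 := by
      funext m
      by_cases hm : m = ⟨I, hI⟩
      · subst hm; exact hf
      · obtain ⟨a, haI, ham⟩ : ∃ a ∈ I, a ∉ m.asIdeal := by
          by_contra! h
          exact hm (MaximalSpectrum.ext (hI.eq_of_le m.isMaximal.ne_top h).symm)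
        have ha : a • f (e.symm 1) = 0 := by
          have : a • (1 : R ⧸ I) = 0 := by
            rw [Algebra.smul_def, mul_one]
            exact Ideal.Quotient.eq_zero_iff_mem.2 haI
          rw [← map_smul, ← map_smul, this, map_zero, map_zero]
        have ha' : Ideal.Quotient.mk m.asIdeal a * f (e.symm 1) m = 0 := by
          simpa [Algebra.smul_def] using congrFun ha m
        have := m.isMaximal
        exact (mul_eq_zero.1 ha').resolve_left fun h => ham (Ideal.Quotient.eq_zero_iff_mem.1 h)
    ext1 x
    obtain ⟨r, hr⟩ := Ideal.Quotient.mk_surjective (e x)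
    have : x = r • e.symm 1 := by
      rw [← map_smul, e.eq_symm_apply, ← hr, Algebra.smul_def, mul_one]
      rfl
    rw [this, map_smul, h, smul_zero, LinearMap.zero_apply]
  have : IsSimpleModule R (R ⧸ I) := isSimpleModule_iff_quot_maximal.2 ⟨I, hI, ⟨.refl _ _⟩⟩
  calc _ ≤ Module.length R (R ⧸ I) := Module.length_le_of_injective φ hφ
    _ = 1 := Module.length_eq_one R _

/-- By essentiality, a nonzero map from a simple module to `X` has image meeting, hence inside, the
image of `ι`. -/
lemma length_linearMap_le_one_of_essential {X : Type u} [AddCommGroup X] [Module R X]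
    (ι : SimpleProduct R →ₗ[R] X)
    (hess : ∀ N : Submodule R X, Disjoint N (LinearMap.range ι) → N = ⊥)
    (k : Type u) [AddCommGroup k] [Module R k] (hk : IsSimpleModule R k) (hι : Function.Injective ι) :
    Module.length R (k →ₗ[R] X) ≤ 1 := by
  refine le_trans (Module.length_le_of_surjective
    (LinearMap.compRight R ι (M := k)) fun f => ?_) (length_linearMap_simpleProduct_le_one k hk)
  rcases eq_bot_or_eq_top ((LinearMap.range ι).comap f) with h | h
  · have hf : LinearMap.range f = ⊥ := by
      refine hess _ (disjoint_iff_inf_le.2 ?_)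
      rintro _ ⟨⟨x, rfl⟩, hx⟩
      have : x ∈ (LinearMap.range ι).comap f := hx
      rw [h, Submodule.mem_bot] at this
      simp [this]
    exact ⟨0, by rw [map_zero, LinearMap.range_eq_bot.1 hf]⟩
  · have hf (x : k) : f x ∈ LinearMap.range ι := by
      have : x ∈ (LinearMap.range ι).comap f := h ▸ Submodule.mem_top
      exact this
    let e := LinearEquiv.ofInjective ι hι
    refine ⟨e.symm.toLinearMap ∘ₗ f.codRestrict _ hf, LinearMap.ext fun x => ?_⟩
    change ι (e.symm ⟨f x, hf x⟩) = f x
    exact congrArg Subtype.val (e.apply_symm_apply ⟨f x, hf x⟩)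

variable (R) in
/-- Over a commutative artinian ring there is a finitely generated injective module containing
every simple module exactly once; `Hom(-, E)` is the Matlis duality. -/
lemma exists_dualizing_module [IsArtinianRing R] :
    ∃ (E : Type u) (_ : AddCommGroup E) (_ : Module R E), Module.Injective R E ∧
      (∀ (k : Type u) [AddCommGroup k] [Module R k], IsSimpleModule R k →
        Module.length R (k →ₗ[R] E) ≤ 1) ∧
      (∀ (k : Type u) [AddCommGroup k] [Module R k], IsSimpleModule R k →
        ∃ f : k →ₗ[R] E, Function.Injective f) := by
  let S := ModuleCat.of R (SimpleProduct R)
  let I : ModuleCat.{u} R := Injective.under S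
  let i : SimpleProduct R →ₗ[R] I := (Injective.ι S).hom
  have hi : Function.Injective i := (ModuleCat.mono_iff_injective (Injective.ι S)).1 inferInstance
  have hI : Module.Injective R I :=
    Module.injective_module_of_injective_object (inj := inferInstanceAs (Injective I))
  -- Dividing `I` by a maximal submodule disjoint from the image of `i` makes the product of simples
  -- essential in the quotient `X`.
  obtain ⟨N, hN⟩ : ∃ N : Submodule R I,
      Maximal (fun N => Disjoint N (LinearMap.range i)) N := by
    refine zorn_le_nonempty₀ {N : Submodule R I | Disjoint N (LinearMap.range i)} ?_ ⊥
      disjoint_bot_left |>.imp fun N h => h.2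
    intro c hc hc' y hy
    refine ⟨sSup c, ?_, fun z hz => le_sSup hz⟩
    change Disjoint _ _
    rw [Submodule.disjoint_def]
    intro x hx hx'
    obtain ⟨z, hz, hxz⟩ := (Submodule.mem_sSup_of_directed ⟨y, hy⟩ hc'.directedOn).1 hx
    exact Submodule.disjoint_def.1 (hc hz) x hxz hx'
  have hdisj : Disjoint N (LinearMap.range i) := hN.prop
  let X := I ⧸ N
  let ι : SimpleProduct R →ₗ[R] X := N.mkQ ∘ₗ i
  have hι : Function.Injective ι := by
    rw [← LinearMap.ker_eq_bot, LinearMap.ker_eq_bot']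
    intro x hx
    have : i x ∈ N := (Submodule.Quotient.mk_eq_zero N).1 hx
    exact hi ((Submodule.disjoint_def.1 hdisj _ this ⟨x, rfl⟩).trans (map_zero i).symm)
  have hess (K : Submodule R X) (hK : Disjoint K (LinearMap.range ι)) : K = ⊥ := by
    have h₁ : Disjoint (K.comap N.mkQ) (LinearMap.range i) := by
      rw [Submodule.disjoint_def]
      rintro _ hx ⟨x, rfl⟩
      have : ι x = 0 := Submodule.disjoint_def.1 hK _ hx ⟨x, rfl⟩
      rw [hι (this.trans (map_zero ι).symm), map_zero]
    have h₂ : N ≤ K.comap N.mkQ := fun x hx => by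
      have : N.mkQ x = 0 := (Submodule.Quotient.mk_eq_zero N).2 hx
      simp [this]
    have h₃ := hN.eq_of_le h₁ h₂
    rw [eq_bot_iff]
    intro x hx
    obtain ⟨x, rfl⟩ := N.mkQ_surjective x
    have : x ∈ K.comap N.mkQ := hx
    rw [← h₃] at this
    exact (Submodule.Quotient.mk_eq_zero N).2 this
  have hlen (k : Type u) [AddCommGroup k] [Module R k] (hk : IsSimpleModule R k) :
      Module.length R (k →ₗ[R] X) ≤ 1 :=
    length_linearMap_le_one_of_essential ι hess k hk hι
  -- The length bound applied to `M = R` gives `X ≅ Hom(R, X)` finite length.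
  have hX : IsArtinian R X := by
    have h₁ : IsFiniteLength R R :=
      isFiniteLength_iff_isNoetherian_isArtinian.2 ⟨inferInstance, inferInstance⟩
    have h₂ := length_linearMap_le_length hlen h₁
    rw [(LinearMap.ringLmapEquivSelf R R X).length_eq] at h₂
    have h₃ := Module.length_ne_top_iff.1 (ne_top_of_le_ne_top (Module.length_ne_top_iff.2 h₁) h₂)
    exact (isFiniteLength_iff_isNoetherian_isArtinian.1 h₃).2
  -- The endomorphism `X → I → X` fixes the image of `ι`, so by essentiality it is injective, and by
  -- the artinian property bijective. Thus `X` is a direct summand of `I` and inherits injectivity.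
  obtain ⟨φ, hφ⟩ := hI.out ι hι i
  have hψ : Function.Injective (N.mkQ ∘ₗ φ) := by
    rw [← LinearMap.ker_eq_bot]
    refine hess _ ?_
    rw [Submodule.disjoint_def]
    rintro _ hx ⟨x, rfl⟩
    exact (congrArg N.mkQ (hφ x)).symm.trans hx
  let e := LinearEquiv.ofBijective _ (IsArtinian.bijective_of_injective_endomorphism _ hψ)
  refine ⟨X, inferInstance, inferInstance, ⟨fun Y Z _ _ _ _ f hf g => ?_⟩, hlen, fun k _ _ hk => ?_⟩
  · obtain ⟨h, hh⟩ := hI.out f hf (φ ∘ₗ g)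
    refine ⟨e.symm.toLinearMap ∘ₗ N.mkQ ∘ₗ h, fun x => ?_⟩
    change e.symm (N.mkQ (h (f x))) = g x
    rw [hh, LinearEquiv.symm_apply_eq]
    rfl
  · obtain ⟨f, hf⟩ := exists_injective_to_simpleProduct k hk
    exact ⟨ι ∘ₗ f, hι.comp hf⟩

end Matlis

/-! ### Reflexivity of finite length modules. -/

section EvalBijective

variable {R : Type u} [CommRing R]

/-- The properties of the dualizing module of a commutative artinian ring. -/
structure IsDualizing (R : Type u) [CommRing R] (E : Type u) [AddCommGroup E] [Module R E] :
    Prop where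
  injective : Module.Injective R E
  length_le_one (k : Type u) [AddCommGroup k] [Module R k] :
    IsSimpleModule R k → Module.length R (k →ₗ[R] E) ≤ 1
  exists_embedding (k : Type u) [AddCommGroup k] [Module R k] :
    IsSimpleModule R k → ∃ f : k →ₗ[R] E, Function.Injective f

variable {E : Type u} [AddCommGroup E] [Module R E] (hE : IsDualizing R E)
include hE

/-- The cyclic module `R x` has a simple quotient, which embeds in `E`; injectivity extends the
resulting map to `M`. -/
lemma IsDualizing.exists_apply_ne_zero {M : Type u} [AddCommGroup M] [Module R M] {x : M}
    (hx : x ≠ 0) : ∃ f : M →ₗ[R] E, f x ≠ 0 := by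
  let I : Ideal R := LinearMap.ker (LinearMap.toSpanSingleton R M x)
  have hI : I ≠ ⊤ := fun h => hx <| by
    have : (1 : R) ∈ I := h ▸ Submodule.mem_top
    simpa [I] using this
  obtain ⟨m, hm, hIm⟩ := I.exists_le_maximal hI
  let j : (R ⧸ I) →ₗ[R] M := I.liftQ (LinearMap.toSpanSingleton R M x) le_rfl
  have hj : Function.Injective j := by
    rw [← LinearMap.ker_eq_bot]
    exact Submodule.ker_liftQ_eq_bot _ _ _ le_rfl
  obtain ⟨i, hi⟩ := hE.exists_embedding (R ⧸ m)
    (isSimpleModule_iff_quot_maximal.2 ⟨m, hm, ⟨.refl _ _⟩⟩)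
  obtain ⟨f, hf⟩ := hE.injective.out j hj (i ∘ₗ Submodule.factor hIm)
  refine ⟨f, ?_⟩
  have h₁ := hf (Submodule.Quotient.mk 1)
  have h₂ : j (Submodule.Quotient.mk 1) = x :=
    (I.liftQ_apply (LinearMap.toSpanSingleton R M x) 1).trans (one_smul R x)
  rw [h₂] at h₁
  rw [h₁]
  change i (Submodule.Quotient.mk 1) ≠ 0
  rw [Ne, ← map_zero i, hi.eq_iff, Submodule.Quotient.mk_eq_zero]
  exact fun h => hm.ne_top ((Ideal.eq_top_iff_one m).2 h)

lemma IsDualizing.isFiniteLength {M : Type u} [AddCommGroup M] [Module R M]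
    (hM : IsFiniteLength R M) : IsFiniteLength R (M →ₗ[R] E) :=
  Module.length_ne_top_iff.1 <| ne_top_of_le_ne_top (Module.length_ne_top_iff.2 hM)
    (length_linearMap_le_length (fun k _ _ hk => hE.length_le_one k hk) hM)

lemma IsDualizing.eval_injective (M : Type u) [AddCommGroup M] [Module R M] :
    Function.Injective (LinearMap.applyₗ : M →ₗ[R] (M →ₗ[R] E) →ₗ[R] E) := by
  rw [← LinearMap.ker_eq_bot, LinearMap.ker_eq_bot']
  intro x hx
  by_contra h
  obtain ⟨f, hf⟩ := hE.exists_apply_ne_zero h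
  exact hf (LinearMap.congr_fun hx f)

/-- Dualizing does not increase length, so the double dual is no longer than `M`; an injection of
`M` into it must be onto. -/
lemma IsDualizing.eval_surjective {M : Type u} [AddCommGroup M] [Module R M]
    (hM : IsFiniteLength R M) :
    Function.Surjective (LinearMap.applyₗ : M →ₗ[R] (M →ₗ[R] E) →ₗ[R] E) := by
  have hs (k : Type u) [AddCommGroup k] [Module R k] (hk : IsSimpleModule R k) :=
    hE.length_le_one k hk
  have h₁ := hE.isFiniteLength hM
  have h₂ := hE.isFiniteLength h₁
  obtain ⟨_, _⟩ := isFiniteLength_iff_isNoetherian_isArtinian.1 h₂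
  have hle := (length_linearMap_le_length hs h₁).trans (length_linearMap_le_length hs hM)
  rw [← LinearMap.range_eq_top]
  by_contra h
  have hlt := Submodule.length_lt h
  rw [← (LinearEquiv.ofInjective _ (hE.eval_injective M)).length_eq] at hlt
  exact hlt.not_ge hle

end EvalBijective

/-! ### Duality between modules over an algebra and over its opposite. -/

section Dual

variable {R : Type u} [CommRing R] {A B : Type u} [Ring A] [Ring B] [Algebra R A] [Algebra R B]

/-- The inverse of an anti-isomorphism of algebras. -/
def antiFlip (σ : B ≃ₐ[R] Aᵐᵒᵖ) : A ≃ₐ[R] Bᵐᵒᵖ := (AlgEquiv.opComm σ).symm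

@[simp]
lemma unop_apply_unop_antiFlip (σ : B ≃ₐ[R] Aᵐᵒᵖ) (a : A) :
    (σ (antiFlip σ a).unop).unop = a :=
  (AlgEquiv.opComm σ).apply_symm_apply a

@[simp]
lemma unop_antiFlip_unop_apply (σ : B ≃ₐ[R] Aᵐᵒᵖ) (b : B) :
    (antiFlip σ (σ b).unop).unop = b :=
  congrArg MulOpposite.unop ((AlgEquiv.opComm σ).symm_apply_apply (MulOpposite.op b))

lemma antiFlip_antiFlip (σ : B ≃ₐ[R] Aᵐᵒᵖ) : antiFlip (antiFlip σ) = σ := by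
  ext b
  exact MulOpposite.unop_injective <| (antiFlip σ).injective <| MulOpposite.unop_injective <|
    (unop_apply_unop_antiFlip (antiFlip σ) b).trans (unop_antiFlip_unop_apply σ b).symm

variable (σ : B ≃ₐ[R] Aᵐᵒᵖ) (E : Type u) [AddCommGroup E] [Module R E]

variable (R A) in
/-- The `R`-linear maps from an `A`-module to `E`. -/
def dualAddSubgroup (M : Type u) [AddCommGroup M] [Module A M] : AddSubgroup (M →+ E) where
  carrier := {f | ∀ (r : R) (x : M), f (algebraMap R A r • x) = r • f x}
  zero_mem' r x := by simp
  add_mem' {f g} hf hg r x := by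
    simp only [Set.mem_ofPred_eq] at hf hg
    simp [hf, hg]
  neg_mem' {f} hf r x := by
    simp only [Set.mem_ofPred_eq] at hf
    simp [hf]

/-- The dual `Hom_R(M, E)` of an `A`-module, as a module over `B ≃ Aᵐᵒᵖ`. -/
def MDual (_σ : B ≃ₐ[R] Aᵐᵒᵖ) (E : Type u) [AddCommGroup E] [Module R E] (M : Type u)
    [AddCommGroup M] [Module A M] : Type u :=
  dualAddSubgroup R A E M

namespace MDual

variable {M N K : Type u} [AddCommGroup M] [Module A M] [AddCommGroup N] [Module A N]
  [AddCommGroup K] [Module A K]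

noncomputable instance : AddCommGroup (MDual σ E M) :=
  inferInstanceAs (AddCommGroup (dualAddSubgroup R A E M))

instance : FunLike (MDual σ E M) M E where
  coe f := f.1
  coe_injective _ _ h := Subtype.ext (DFunLike.coe_injective h)

instance : AddMonoidHomClass (MDual σ E M) M E where
  map_add f := f.1.map_add
  map_zero f := f.1.map_zero

variable {σ E}

@[ext]
lemma ext {f g : MDual σ E M} (h : ∀ x, f x = g x) : f = g := DFunLike.ext f g h

lemma map_algebraMap_smul (f : MDual σ E M) (r : R) (x : M) :
    f (algebraMap R A r • x) = r • f x := f.2 r x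

@[simp] lemma add_apply (f g : MDual σ E M) (x : M) : (f + g) x = f x + g x := rfl

@[simp] lemma zero_apply (x : M) : (0 : MDual σ E M) x = 0 := rfl

variable (σ) in
/-- Construct an element of the dual from a function. -/
def mk (f : M → E) (hadd : ∀ x y, f (x + y) = f x + f y)
    (hsmul : ∀ (r : R) (x : M), f (algebraMap R A r • x) = r • f x) : MDual σ E M :=
  ⟨AddMonoidHom.mk' f hadd, hsmul⟩

@[simp]
lemma mk_apply (f : M → E) (hadd : ∀ x y, f (x + y) = f x + f y)
    (hsmul : ∀ (r : R) (x : M), f (algebraMap R A r • x) = r • f x) (x : M) :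
    mk σ f hadd hsmul x = f x := rfl

lemma unop_map_algebraMap (r : R) : (σ (algebraMap R B r)).unop = algebraMap R A r := by
  rw [AlgEquiv.commutes]
  rfl

noncomputable instance : SMul B (MDual σ E M) where
  smul b f := mk σ (fun x => f ((σ b).unop • x)) (fun x y => by rw [smul_add, map_add])
    fun r x => by rw [← map_algebraMap_smul, ← mul_smul, ← mul_smul, Algebra.commutes]

@[simp]
lemma smul_apply (b : B) (f : MDual σ E M) (x : M) : (b • f) x = f ((σ b).unop • x) := rfl

noncomputable instance : Module B (MDual σ E M) where
  one_smul f := by ext; simp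
  mul_smul a b f := by ext; simp [mul_smul]
  smul_zero b := by ext; simp
  smul_add b f g := by ext; simp
  add_smul a b f := by ext; simp [add_smul]
  zero_smul f := by ext; simp

lemma algebraMap_smul_apply (r : R) (f : MDual σ E M) (x : M) :
    (algebraMap R B r • f) x = r • f x := by
  rw [smul_apply, unop_map_algebraMap, map_algebraMap_smul]

variable (σ E) in
/-- The dual of a linear map. -/
noncomputable def map (φ : M →ₗ[A] N) : MDual σ E N →ₗ[B] MDual σ E M where
  toFun f := mk σ (fun x => f (φ x)) (fun x y => by simp)
    fun r x => by rw [map_smul, map_algebraMap_smul]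
  map_add' f g := rfl
  map_smul' b f := by ext; simp

@[simp]
lemma map_apply (φ : M →ₗ[A] N) (f : MDual σ E N) (x : M) : map σ E φ f x = f (φ x) := rfl

lemma map_injective {φ : M →ₗ[A] N} (hφ : Function.Surjective φ) :
    Function.Injective (map σ E φ) := fun f g h => by
  ext x
  obtain ⟨x, rfl⟩ := hφ x
  exact DFunLike.congr_fun h x

lemma map_surjective (hE : Module.Injective R E) {φ : M →ₗ[A] N} (hφ : Function.Injective φ) :
    Function.Surjective (map σ E φ) := fun f => by
  let := Module.restrictScalars R A M
  let := Module.restrictScalars R A N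
  let φ' : M →ₗ[R] N := { φ.toAddMonoidHom with map_smul' := fun r x => φ.map_smul _ x }
  let f' : M →ₗ[R] E := { f.1 with map_smul' := fun r x => map_algebraMap_smul f r x }
  obtain ⟨g, hg⟩ := hE.out φ' hφ f'
  exact ⟨mk σ g (map_add g) fun r x => g.map_smul r x, ext hg⟩

lemma map_exact {φ : M →ₗ[A] N} {ψ : N →ₗ[A] K} (h : Function.Exact φ ψ)
    (hψ : Function.Surjective ψ) : Function.Exact (map σ E ψ) (map σ E φ) := by
  intro f
  constructor
  · intro hf
    have hker (x y : N) (hxy : ψ x = ψ y) : f x = f y := by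
      obtain ⟨z, hz⟩ := (h (x - y)).1 (by rw [map_sub, hxy, sub_self])
      rw [← sub_eq_zero, ← map_sub, ← hz]
      exact DFunLike.congr_fun hf z
    let s := Function.surjInv hψ
    have hs (x : K) : ψ (s x) = x := Function.surjInv_eq hψ x
    refine ⟨mk σ (fun x => f (s x)) (fun x y => ?_) (fun r x => ?_), ext fun x => ?_⟩
    · rw [← map_add]
      exact hker _ _ (by simp [hs])
    · rw [← map_algebraMap_smul]
      exact hker _ _ (by simp [hs])
    · exact hker _ _ (hs _)
  · rintro ⟨f, rfl⟩
    ext x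
    simp [h.apply_apply_eq_zero x]

/-- A `B`-linear map `N → Hom_R(P, E)` is the same as an `A`-linear map `P → Hom_R(N, E)`. -/
noncomputable def swap {N : Type u} [AddCommGroup N] [Module B N] (φ : N →ₗ[B] MDual σ E M) :
    M →ₗ[A] MDual (antiFlip σ) E N where
  toFun x := mk _ (fun n => φ n x) (fun n n' => by simp)
    fun r n => by rw [map_smul, algebraMap_smul_apply]
  map_add' x y := by ext n; simp
  map_smul' a x := by ext n; simp

@[simp]
lemma swap_apply {N : Type u} [AddCommGroup N] [Module B N] (φ : N →ₗ[B] MDual σ E M) (x : M)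
    (n : N) : swap φ x n = φ n x := rfl

/-- The inverse of `MDual.swap`. -/
noncomputable def unswap {N : Type u} [AddCommGroup N] [Module B N]
    (ψ : M →ₗ[A] MDual (antiFlip σ) E N) : N →ₗ[B] MDual σ E M where
  toFun n := mk _ (fun x => ψ x n) (fun n n' => by simp)
    fun r x => by rw [map_smul, algebraMap_smul_apply]
  map_add' x y := by ext n; simp
  map_smul' a x := by ext n; simp

@[simp]
lemma unswap_apply {N : Type u} [AddCommGroup N] [Module B N]
    (ψ : M →ₗ[A] MDual (antiFlip σ) E N) (x : M) (n : N) : unswap ψ n x = ψ x n := rfl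

/-- Under `swap`, extending along `f` into the dual of `P` becomes lifting from `P` along the
surjection dual to `f`. -/
lemma injective_of_projective (hE : Module.Injective R E) (P : Type u) [AddCommGroup P]
    [Module A P] [Module.Projective A P] : Module.Injective B (MDual σ E P) where
  out X Y _ _ _ _ f hf g := by
    obtain ⟨h, hh⟩ := Module.projective_lifting_property (map (antiFlip σ) E f) (swap g)
      (map_surjective hE hf)
    refine ⟨unswap h, fun x => ext fun p => ?_⟩
    exact DFunLike.congr_fun (LinearMap.congr_fun hh p) x

variable (σ E) in
/-- The evaluation map to the double dual. -/
noncomputable def eval (M : Type u) [AddCommGroup M] [Module A M] :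
    M →ₗ[A] MDual (antiFlip σ) E (MDual σ E M) := swap LinearMap.id

@[simp]
lemma eval_apply (x : M) (f : MDual σ E M) : eval σ E M x f = f x := rfl

lemma eval_injective (hE : IsDualizing R E) : Function.Injective (eval σ E M) := by
  let := Module.restrictScalars R A M
  rw [← LinearMap.ker_eq_bot, LinearMap.ker_eq_bot']
  intro x hx
  by_contra h
  obtain ⟨f, hf⟩ := hE.exists_apply_ne_zero h
  exact hf (DFunLike.congr_fun hx (mk σ f (map_add f) fun r x => f.map_smul r x))

variable [IsArtinianRing R]

lemma isFiniteLength_restrictScalars [Module.Finite R A] [Module.Finite A M] :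
    let := Module.restrictScalars R A M
    IsFiniteLength R M := by
  let := Module.restrictScalars R A M
  have := IsScalarTower.restrictScalars R A M
  have := Module.Finite.trans (R := R) A M
  exact isFiniteLength_iff_isNoetherian_isArtinian.2 ⟨inferInstance, inferInstance⟩

lemma eval_surjective (hE : IsDualizing R E) [Module.Finite R A] [Module.Finite A M] :
    Function.Surjective (eval σ E M) := fun F => by
  let := Module.restrictScalars R A M
  let F' : (M →ₗ[R] E) →ₗ[R] E :=
    { toFun := fun f => F (mk σ f (map_add f) fun r x => f.map_smul r x)
      map_add' := fun f g => map_add F (mk σ f _ _) (mk σ g _ _)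
      map_smul' := fun r f => by
        rw [RingHom.id_apply, ← map_algebraMap_smul]
        congr 1
        ext x
        rw [algebraMap_smul_apply]
        rfl }
  obtain ⟨x, hx⟩ := hE.eval_surjective (isFiniteLength_restrictScalars (A := A)) F'
  refine ⟨x, ext fun f => ?_⟩
  exact LinearMap.congr_fun hx { f.1 with map_smul' := fun r x => map_algebraMap_smul f r x }

lemma finite (hE : IsDualizing R E) [Module.Finite R A] [Module.Finite A M] :
    Module.Finite B (MDual σ E M) := by
  let := Module.restrictScalars R A M
  let := Module.restrictScalars R B (MDual σ E M)
  have := IsScalarTower.restrictScalars R B (MDual σ E M)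
  have h := hE.isFiniteLength (isFiniteLength_restrictScalars (R := R) (A := A) (M := M))
  have : IsNoetherian R (M →ₗ[R] E) := (isFiniteLength_iff_isNoetherian_isArtinian.1 h).1
  let θ : (M →ₗ[R] E) →ₗ[R] MDual σ E M :=
    { toFun := fun f => mk σ f (map_add f) fun r x => f.map_smul r x
      map_add' := fun f g => rfl
      map_smul' := fun r f => by
        ext x
        change _ = (algebraMap R B r • _ : MDual σ E M) x
        rw [algebraMap_smul_apply]
        rfl }
  have hθ : Function.Surjective θ := fun f =>
    ⟨{ f.1 with map_smul' := fun r x => map_algebraMap_smul f r x }, rfl⟩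
  have := Module.Finite.of_surjective θ hθ
  exact Module.Finite.of_restrictScalars_finite R B _

variable (σ E M) in
/-- A finitely generated module embeds in a finite power of the dual of the ring. -/
lemma exists_embedding (hE : IsDualizing R E) [Module.Finite R A] [Module.Finite A M] :
    ∃ (m : ℕ) (f : M →ₗ[A] (Fin m → MDual (antiFlip σ) E B)), Function.Injective f := by
  have := finite (σ := σ) (M := M) hE
  obtain ⟨m, φ, hφ⟩ := Module.Finite.exists_fin (R := B) (M := MDual σ E M)
  -- A generator `φ i` of the dual is a map from `B` to the dual of `M`; swapping gives a map from
  -- `M` to the dual of `B`. An element killed by all of them is killed by the whole dual.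
  refine ⟨m, LinearMap.pi fun i => swap (LinearMap.toSpanSingleton B _ (φ i)), ?_⟩
  rw [← LinearMap.ker_eq_bot, LinearMap.ker_eq_bot']
  intro x hx
  refine eval_injective (σ := σ) hE ?_
  ext f
  rw [map_zero, zero_apply, eval_apply]
  have hf : f ∈ Submodule.span B (Set.range φ) := hφ ▸ Submodule.mem_top
  induction hf using Submodule.closure_induction with
  | zero => rfl
  | add f g _ _ hf hg => rw [add_apply, hf, hg, add_zero]
  | smul_mem b f hf =>
    obtain ⟨i, rfl⟩ := hf
    exact DFunLike.congr_fun (congrFun hx i) b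

/-- A retraction of the dual of `π` exists by injectivity; dualizing it and identifying `P` with its
double dual yields the section. -/
lemma exists_section_of_injective (hE : IsDualizing R E) [Module.Finite R A]
    {P : Type u} [AddCommGroup P] [Module A P] [Module.Finite A P]
    (hM : Module.Injective B (MDual σ E M)) {π : P →ₗ[A] M} (hπ : Function.Surjective π) :
    ∃ s : M →ₗ[A] P, π ∘ₗ s = LinearMap.id := by
  obtain ⟨r, hr⟩ := hM.out (map σ E π) (map_injective hπ) LinearMap.id
  let e := LinearEquiv.ofBijective (eval σ E P) ⟨eval_injective hE, eval_surjective hE⟩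
  refine ⟨e.symm.toLinearMap ∘ₗ map (antiFlip σ) E r ∘ₗ eval σ E M, LinearMap.ext fun x => ?_⟩
  refine eval_injective (σ := σ) hE (ext fun f => ?_)
  have h : eval σ E P (e.symm (map (antiFlip σ) E r (eval σ E M x))) = _ := e.apply_symm_apply _
  have h' := DFunLike.congr_fun h (map σ E π f)
  simp only [map_apply, eval_apply, hr, LinearMap.id_apply] at h'
  exact h'

end MDual

end Dual

/-! ### Homological dimension of powers and of syzygies. -/

section Dimension

variable {A : Type u} [Ring A]

/-- The power `Wᵐ` of a module, as an object of the module category. -/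
abbrev powObj (W : ModuleCat.{u} A) (m : ℕ) : ModuleCat.{u} A := ModuleCat.of A (Fin m → W)

/-- `Wᵐ⁺¹ ≅ W ⊞ Wᵐ`. -/
noncomputable def powObjSuccIso (W : ModuleCat.{u} A) (m : ℕ) :
    powObj W (m + 1) ≅ W ⊞ powObj W m :=
  LinearEquiv.toModuleIso
    ({ toFun := fun f => (f 0, Fin.tail f)
       map_add' := fun f g => rfl
       map_smul' := fun a f => rfl
       invFun := fun p => Fin.cons p.1 p.2
       left_inv := fun f => Fin.cons_self_tail f
       right_inv := fun p => by simp } :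
      (Fin (m + 1) → W) ≃ₗ[A] W × (Fin m → W)) ≪≫ (ModuleCat.biprodIsoProd W (powObj W m)).symm

lemma isZero_powObj_zero (W : ModuleCat.{u} A) : Limits.IsZero (powObj W 0) :=
  ModuleCat.isZero_of_subsingleton _

lemma hasProjectiveDimensionLT_powObj (W : ModuleCat.{u} A) (d : ℕ) [HasProjectiveDimensionLT W d]
    (m : ℕ) : HasProjectiveDimensionLT (powObj W m) d := by
  induction m with
  | zero =>
    have := (isZero_powObj_zero W).hasProjectiveDimensionLT_zero
    exact hasProjectiveDimensionLT_of_ge _ 0 d d.zero_le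
  | succ m ih => exact hasProjectiveDimensionLT_of_iso (powObjSuccIso W m).symm d

lemma hasInjectiveDimensionLT_powObj (W : ModuleCat.{u} A) (d : ℕ) [HasInjectiveDimensionLT W d]
    (m : ℕ) : HasInjectiveDimensionLT (powObj W m) d := by
  induction m with
  | zero =>
    have := (isZero_powObj_zero W).hasInjectiveDimensionLT_zero
    exact hasInjectiveDimensionLT_of_ge _ 0 d d.zero_le
  | succ m ih => exact hasInjectiveDimensionLT_of_iso (powObjSuccIso W m).symm d

lemma isFG_powObj {W : ModuleCat.{u} A} (hW : ModuleCat.isFG A W) (m : ℕ) :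
    ModuleCat.isFG A (powObj W m) := by
  have : Module.Finite A W := hW
  exact inferInstanceAs (Module.Finite A (Fin m → W))

lemma exists_retract_powObj {Q : ModuleCat.{u} A} (hQ : ModuleCat.isFG A Q) [Projective Q] :
    ∃ m, Nonempty (Retract Q (powObj (ModuleCat.of A A) m)) := by
  have : Module.Finite A Q := hQ
  obtain ⟨m, φ, hφ⟩ := Module.Finite.exists_fin' A Q
  let g : powObj (ModuleCat.of A A) m ⟶ Q := ModuleCat.ofHom φ
  have : Epi g := (ModuleCat.epi_iff_surjective _).2 hφ
  exact ⟨m, ⟨⟨Projective.factorThru (𝟙 Q) g, g, Projective.factorThru_comp _ _⟩⟩⟩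

lemma hasInjectiveDimensionLT_of_projective {d : ℕ}
    (hA : HasInjectiveDimensionLT (ModuleCat.of A A) d) {Q : ModuleCat.{u} A}
    (hQ : ModuleCat.isFG A Q) [Projective Q] : HasInjectiveDimensionLT Q d := by
  obtain ⟨m, ⟨r⟩⟩ := exists_retract_powObj hQ
  have := hasInjectiveDimensionLT_powObj (ModuleCat.of A A) d m
  exact r.hasInjectiveDimensionLT d

lemma IsSyzygy.projective : ∀ {k : ℕ} {M L : ModuleCat.{u} A}, IsSyzygy k M L →
    HasProjectiveDimensionLT M (k + 1) → Projective L
  | 0, _, _, ⟨e⟩, _ => by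
    exact (projective_iff_hasProjectiveDimensionLT_one).2 (hasProjectiveDimensionLT_of_iso e 1)
  | k + 1, _, _, ⟨_, _, _, _, _, hS, _, hP, h⟩, hM =>
    h.projective ((hS.hasProjectiveDimensionLT_X₃_iff k hP).1 hM)

lemma IsCosyzygy.injective : ∀ {k : ℕ} {M L : ModuleCat.{u} A}, IsCosyzygy k M L →
    HasInjectiveDimensionLT M (k + 1) → Injective L
  | 0, _, _, ⟨e⟩, _ => by
    exact (injective_iff_hasInjectiveDimensionLT_one).2 (hasInjectiveDimensionLT_of_iso e 1)
  | k + 1, _, _, ⟨_, _, _, _, _, hS, _, hI, h⟩, hM =>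
    h.injective ((hS.hasInjectiveDimensionLT_X₃_iff k hI).2 hM)

lemma shortExact_functionExact {S : ShortComplex (ModuleCat.{u} A)} (hS : S.ShortExact) :
    Function.Injective S.f.hom ∧ Function.Exact S.f.hom S.g.hom ∧ Function.Surjective S.g.hom :=
  ⟨(ModuleCat.mono_iff_injective _).1 hS.mono_f,
    (ShortComplex.ShortExact.moduleCat_exact_iff_function_exact _).1 hS.exact,
    (ModuleCat.epi_iff_surjective _).1 hS.epi_g⟩

end Dimension

/-! ### Duality exchanges projective and injective dimension. -/

section Duality

variable {R : Type u} [CommRing R] {A B : Type u} [Ring A] [Ring B] [Algebra R A] [Algebra R B]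
  (σ : B ≃ₐ[R] Aᵐᵒᵖ) {E : Type u} [AddCommGroup E] [Module R E]

variable (E) in
/-- The dual of a module as an object of the module category. -/
noncomputable abbrev dualObj (M : ModuleCat.{u} A) : ModuleCat.{u} B := ModuleCat.of B (MDual σ E M)

variable (E) in
/-- The dual as an operation on morphisms. -/
noncomputable abbrev dualMap {M N : ModuleCat.{u} A} (f : M ⟶ N) : dualObj σ E N ⟶ dualObj σ E M :=
  ModuleCat.ofHom (MDual.map σ E f.hom)

lemma dualMap_comp {M N K : ModuleCat.{u} A} {f : M ⟶ N} {g : N ⟶ K} (w : f ≫ g = 0) :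
    dualMap σ E g ≫ dualMap σ E f = 0 := by
  ext φ
  refine MDual.ext (σ := σ) fun x => ?_
  have : g (f x) = 0 := by rw [← ModuleCat.comp_apply, w]; rfl
  change φ (g (f x)) = 0
  rw [this, map_zero]

lemma dual_shortExact (hE : Module.Injective R E) {S : ShortComplex (ModuleCat.{u} A)}
    (hS : S.ShortExact) :
    (ShortComplex.mk (dualMap σ E S.g) (dualMap σ E S.f) (dualMap_comp σ S.zero)).ShortExact := by
  obtain ⟨h₁, h₂, h₃⟩ := shortExact_functionExact hS
  exact
    { exact := (ShortComplex.ShortExact.moduleCat_exact_iff_function_exact _).2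
        (MDual.map_exact h₂ h₃)
      mono_f := (ModuleCat.mono_iff_injective _).2 (MDual.map_injective h₃)
      epi_g := (ModuleCat.epi_iff_surjective _).2 (MDual.map_surjective hE h₁) }

lemma injective_dualObj (hE : Module.Injective R E) (P : ModuleCat.{u} A) [Projective P] :
    Injective (dualObj σ E P) :=
  have := MDual.injective_of_projective (σ := σ) hE P
  Module.injective_object_of_injective_module _ _

/-- The dual as an operation on isomorphisms. -/
noncomputable def dualIso {M N : ModuleCat.{u} A} (e : M ≅ N) : dualObj σ E N ≅ dualObj σ E M where
  hom := dualMap σ E e.hom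
  inv := dualMap σ E e.inv
  hom_inv_id := by
    ext φ
    refine MDual.ext (σ := σ) fun x => ?_
    change φ ((e.inv ≫ e.hom) x) = φ x
    rw [e.inv_hom_id, ModuleCat.id_apply]
  inv_hom_id := by
    ext φ
    refine MDual.ext (σ := σ) fun x => ?_
    change φ ((e.hom ≫ e.inv) x) = φ x
    rw [e.hom_inv_id, ModuleCat.id_apply]

/-- The exact dual turns a projective resolution of `M` into an injective coresolution of its dual.
-/
lemma IsSyzygy.hasInjectiveDimensionLT_dualObj (hE : Module.Injective R E) :
    ∀ {k : ℕ} {M L : ModuleCat.{u} A}, IsSyzygy k M L → Projective L →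
      HasInjectiveDimensionLT (dualObj σ E M) (k + 1)
  | 0, _, L, ⟨e⟩, _ => by
    have := injective_dualObj σ hE L
    exact hasInjectiveDimensionLT_of_iso (dualIso σ e) 1
  | k + 1, _, _, ⟨_, P, _, _, _, hS, _, _, h⟩, hL => by
    have := h.hasInjectiveDimensionLT_dualObj hE hL
    have := injective_dualObj σ hE P
    exact ((dual_shortExact σ hE hS).hasInjectiveDimensionLT_X₃_iff k this).1 ‹_›

lemma IsSyzygy.injective_dualObj (hE : Module.Injective R E) :
    ∀ {k : ℕ} {M L : ModuleCat.{u} A}, IsSyzygy k M L →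
      HasInjectiveDimensionLT (dualObj σ E M) (k + 1) → Injective (dualObj σ E L)
  | 0, _, _, ⟨e⟩, _ => by
    exact (injective_iff_hasInjectiveDimensionLT_one).2
      (hasInjectiveDimensionLT_of_iso (dualIso (E := E) σ e.symm) 1)
  | k + 1, _, _, ⟨_, P, _, _, _, hS, _, _, h⟩, hM => by
    have := GorensteinCT.injective_dualObj σ hE P
    exact h.injective_dualObj hE
      (((dual_shortExact σ hE hS).hasInjectiveDimensionLT_X₃_iff k this).2 hM)

lemma projective_of_injective_dualObj [IsArtinianRing R] [Module.Finite R A] (hE : IsDualizing R E) {M : ModuleCat.{u} A}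
    (hM : ModuleCat.isFG A M) (h : Injective (dualObj σ E M)) : Projective M := by
  have : Module.Finite A M := hM
  obtain ⟨m, φ, hφ⟩ := Module.Finite.exists_fin' A M
  obtain ⟨s, hs⟩ := MDual.exists_section_of_injective (σ := σ) hE
    (Module.injective_module_of_injective_object (inj := h) _ _) hφ
  have : Projective (powObj (ModuleCat.of A A) m) :=
    ModuleCat.projective_of_free (Pi.basisFun A (Fin m))
  exact (Retract.mk (Y := powObj (ModuleCat.of A A) m) (ModuleCat.ofHom s) (ModuleCat.ofHom φ)
    (ModuleCat.hom_ext hs)).projective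

variable (E) in
/-- The dual of the regular `B`-module, an injective cogenerator of the category of
`A`-modules. -/
noncomputable abbrev cogenerator : ModuleCat.{u} A := dualObj (antiFlip σ) E (ModuleCat.of B B)

lemma isFG_cogenerator [IsArtinianRing R] [Module.Finite R B] (hE : IsDualizing R E) :
    ModuleCat.isFG A (cogenerator σ E) :=
  MDual.finite (σ := antiFlip σ) (M := B) hE

lemma injective_cogenerator (hE : IsDualizing R E) : Injective (cogenerator σ E) :=
  have : Projective (ModuleCat.of B B) := (IsProjective.iff_projective B).1 inferInstance
  injective_dualObj (antiFlip σ) hE.injective _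

lemma injective_powObj {W : ModuleCat.{u} A} (hW : Injective W) (m : ℕ) :
    Injective (powObj W m) := by
  have := hasInjectiveDimensionLT_powObj W 1 m
  infer_instance

variable [IsArtinianRing R] [Module.Finite R A]

lemma exists_mono_powObj_cogenerator (hE : IsDualizing R E) {M : ModuleCat.{u} A}
    (hM : ModuleCat.isFG A M) : ∃ (m : ℕ) (f : M ⟶ powObj (cogenerator σ E) m), Mono f := by
  have : Module.Finite A M := hM
  obtain ⟨m, f, hf⟩ := MDual.exists_embedding σ E M hE
  exact ⟨m, ModuleCat.ofHom f, (ModuleCat.mono_iff_injective _).2 hf⟩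

lemma exists_retract_powObj_cogenerator (hE : IsDualizing R E) {J : ModuleCat.{u} A}
    (hJ : ModuleCat.isFG A J) [Injective J] :
    ∃ m, Nonempty (Retract J (powObj (cogenerator σ E) m)) := by
  obtain ⟨m, f, hf⟩ := exists_mono_powObj_cogenerator σ hE hJ
  exact ⟨m, ⟨⟨f, Injective.factorThru (𝟙 J) f, Injective.comp_factorThru _ _⟩⟩⟩

/-- The double dual of the regular module. -/
noncomputable def dualCogeneratorIso [Module.Finite R B] (hE : IsDualizing R E) :
    ModuleCat.of B B ≅ dualObj σ E (cogenerator σ E) :=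
  LinearEquiv.toModuleIso <|
    (LinearEquiv.ofBijective (MDual.eval (antiFlip σ) E B)
      ⟨MDual.eval_injective hE, MDual.eval_surjective hE⟩).trans
    -- Evaluation lands in the dual formed with the twice flipped `σ`, which equals `σ` only
    -- propositionally.
    (LinearEquiv.cast (R := B) (M := fun τ => MDual τ E (MDual (antiFlip σ) E B))
      (antiFlip_antiFlip σ))

lemma exists_injective_presentation (σ : B ≃ₐ[R] Aᵐᵒᵖ) [Module.Finite R B] (hE : IsDualizing R E)
    {M : ModuleCat.{u} A} (hM : ModuleCat.isFG A M) :
    ∃ (I K : ModuleCat.{u} A) (f : M ⟶ I) (g : I ⟶ K) (w : f ≫ g = 0),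
      (ShortComplex.mk f g w).ShortExact ∧ ModuleCat.isFG A I ∧ Injective I := by
  obtain ⟨m, f, hf⟩ := exists_mono_powObj_cogenerator σ hE hM
  exact ⟨_, Limits.cokernel f, f, Limits.cokernel.π f, Limits.cokernel.condition f,
    { exact := ShortComplex.exact_cokernel f }, isFG_powObj (isFG_cogenerator σ hE) m,
    injective_powObj (injective_cogenerator σ hE) m⟩

lemma exists_isCosyzygy (σ : B ≃ₐ[R] Aᵐᵒᵖ) [Module.Finite R B] (hE : IsDualizing R E) (k : ℕ) :
    ∀ {M : ModuleCat.{u} A}, ModuleCat.isFG A M → ∃ L, IsCosyzygy k M L := by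
  induction k with
  | zero => exact fun {M} _ => ⟨M, ⟨Iso.refl M⟩⟩
  | succ k ih =>
    intro M hM
    obtain ⟨I, K, f, g, w, hS, hI, hI'⟩ := exists_injective_presentation σ hE hM
    obtain ⟨L, hL⟩ := ih (isFG_X₃ hS hI)
    exact ⟨L, I, K, f, g, w, hS, hI, hI', hL⟩

/-- The dual of the `k`-th syzygy of the cogenerator is a `k`-th cosyzygy of `B`, hence injective,
so that syzygy is projective. Every finitely generated injective is a summand of a power of the
cogenerator. -/
lemma hasProjectiveDimensionLT_of_injective (σ : B ≃ₐ[R] Aᵐᵒᵖ) [Module.Finite R B] [IsNoetherianRing A]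
    (hE : IsDualizing R E) {k : ℕ} (hB : HasInjectiveDimensionLT (ModuleCat.of B B) (k + 1))
    {J : ModuleCat.{u} A} (hJ : ModuleCat.isFG A J) [Injective J] :
    HasProjectiveDimensionLT J (k + 1) := by
  obtain ⟨L, hL⟩ := exists_isSyzygy k (isFG_cogenerator σ hE)
  have h₁ := hasInjectiveDimensionLT_of_iso (dualCogeneratorIso σ hE) (k + 1)
  have h₂ := hL.injective_dualObj σ hE.injective h₁
  have h₃ := projective_of_injective_dualObj σ hE (hL.isFG (isFG_cogenerator σ hE)) h₂
  have h₄ := hL.hasProjectiveDimensionLT h₃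
  obtain ⟨m, ⟨r⟩⟩ := exists_retract_powObj_cogenerator σ hE hJ
  have := hasProjectiveDimensionLT_powObj (cogenerator σ E) (k + 1) m
  exact r.hasProjectiveDimensionLT _

end Duality

/-! ### Cycles of totally acyclic complexes. -/

section Cycles

variable {A : Type u} [Ring A]

lemma isSyzygy_cycles {K : CochainComplex (ModuleCat.{u} A) ℤ} (hK : K.Acyclic)
    (hfg : ∀ j, ModuleCat.isFG A (K.X j)) (hP : ∀ j, Projective (K.X j)) (j : ℤ) :
    ∀ k : ℕ, IsSyzygy k (K.cycles (j + k)) (K.cycles j)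
  | 0 => ⟨eqToIso (by simp)⟩
  | k + 1 => by
    rw [show j + ((k + 1 : ℕ) : ℤ) = j + k + 1 by push_cast; ring]
    exact ⟨_, _, _, _, _, shortExact_cycles hK (j + k), hfg _, hP _,
      isSyzygy_cycles hK hfg hP j k⟩

lemma isCosyzygy_cycles {K : CochainComplex (ModuleCat.{u} A) ℤ} (hK : K.Acyclic)
    (hfg : ∀ j, ModuleCat.isFG A (K.X j)) (hI : ∀ j, Injective (K.X j)) :
    ∀ (k : ℕ) (j : ℤ), IsCosyzygy k (K.cycles j) (K.cycles (j + k))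
  | 0, j => ⟨eqToIso (by simp)⟩
  | k + 1, j => by
    rw [show j + ((k + 1 : ℕ) : ℤ) = j + 1 + k by push_cast; ring]
    exact ⟨_, _, _, _, _, shortExact_cycles hK j, hfg _, hI _,
      isCosyzygy_cycles hK hfg hI k (j + 1)⟩

variable {n : ℕ} {C : ObjectProperty (ModuleCat.{u} A)}

/-- Total acyclicity gives `Ext^1` for every cycle, also between multiples of `n`; higher degrees at
`Z^{j+1}` descend to `Z^j`, so the induction runs over all `j` at once. -/
lemma IsZTotallyAcyclic.projAcyclic_cycles {P : CochainComplex (ModuleCat.{u} A) ℤ}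
    (hP : IsZTotallyAcyclic n C P) (hn : 0 < n) (j : ℤ) : ProjAcyclic (P.cycles j) := by
  intro Q hQ hQ' m hm
  induction m, hm using Nat.le_induction generalizing j with
  | base =>
    obtain ⟨j, rfl⟩ : ∃ c, j = c + 1 := ⟨j - 1, by simp⟩
    have := hP.projective j
    exact subsingleton_ext_one_of_exists_extension (shortExact_cycles hP.acyclic j)
      (subsingleton_ext_of_projective Q Nat.one_pos)
      (exists_extension_of_homFromSegmentAcyclic hP.acyclic hn (hP.hom_acyclic Q hQ hQ') j)
  | succ m hm ih =>
    obtain ⟨j, rfl⟩ : ∃ c, j = c + 1 := ⟨j - 1, by simp⟩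
    have := hP.projective j
    exact subsingleton_ext_succ_X₃ (shortExact_cycles hP.acyclic j) (ih j)
      (subsingleton_ext_of_projective Q m.succ_pos)

lemma IsZTotallyAcyclicInj.injAcyclic_cycles {I : CochainComplex (ModuleCat.{u} A) ℤ}
    (hI : IsZTotallyAcyclicInj n C I) (hn : 0 < n) (j : ℤ) : InjAcyclic (I.cycles j) := by
  intro J hJ hJ' m hm
  induction m, hm using Nat.le_induction generalizing j with
  | base =>
    have := hI.injective j
    exact subsingleton_ext_one_of_exists_lift (shortExact_cycles hI.acyclic j)
      (subsingleton_ext_of_injective J Nat.one_pos)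
      (exists_lift_of_homToSegmentAcyclic hn (hI.hom_acyclic J hJ hJ') j)
  | succ m hm ih =>
    have := hI.injective j
    exact subsingleton_ext_succ_X₁ (shortExact_cycles hI.acyclic j) (ih (j + 1))
      (subsingleton_ext_of_injective J m.succ_pos)

/-- An `nℤ`-Gorenstein projective syzygy of an injective module is projective. -/
lemma IsZGorensteinProjective.projective_of_isSyzygy (hn : 0 < n) {k : ℕ} {J L : ModuleCat.{u} A}
    [Injective J] (h : IsSyzygy k J L) (hL : IsZGorensteinProjective n C L) : Projective L := by
  obtain ⟨-, P, i, hP, ⟨e⟩⟩ := hL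
  let z : ℤ := i * n
  have h₁ : Subsingleton (Ext (P.cycles (z + 1 + k)) L (1 + k)) :=
    (h.subsingleton_ext_iff_of_projAcyclic (hP.projAcyclic_cycles hn _) Nat.one_pos).1
      (subsingleton_ext_of_injective _ Nat.one_pos)
  have h₂ : Subsingleton (Ext (P.cycles (z + 1)) L 1) :=
    ((isSyzygy_cycles hP.acyclic hP.fg hP.projective (z + 1) k).subsingleton_ext_iff L
      Nat.one_pos).2 h₁
  have := hP.projective z
  -- `L` is the cycle at `z`, so the vanishing splits the sequence ending in `Z^{z+1}`.
  have h₃ := projective_X₁_of_subsingleton_ext_one (shortExact_cycles hP.acyclic z)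
    (subsingleton_ext_of_iso_right e h₂)
  exact Projective.of_iso e.symm h₃

/-- An `nℤ`-Gorenstein injective cosyzygy of a projective module is injective. -/
lemma IsZGorensteinInjective.injective_of_isCosyzygy (hn : 0 < n) {k : ℕ} {Q L : ModuleCat.{u} A}
    [Projective Q] (h : IsCosyzygy k Q L) (hL : IsZGorensteinInjective n C L) : Injective L := by
  obtain ⟨-, I, i, hI, ⟨e⟩⟩ := hL
  -- Dually, `L` has to be the right-hand term of the split sequence, so its index is written `z +
  -- 1`.
  obtain ⟨z, hz⟩ : ∃ z : ℤ, i * n = z + 1 := ⟨i * n - 1, by simp⟩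
  replace e : L ≅ I.cycles (z + 1) := e ≪≫ eqToIso (congrArg (fun j => I.cycles j) hz)
  have h₁ : Subsingleton (Ext L (I.cycles (z - k)) (1 + k)) :=
    (h.subsingleton_ext_iff_of_injAcyclic (hI.injAcyclic_cycles hn _) Nat.one_pos).1
      (subsingleton_ext_of_projective _ Nat.one_pos)
  have hz' := isCosyzygy_cycles hI.acyclic hI.fg hI.injective k (z - k)
  rw [sub_add_cancel] at hz'
  have h₂ : Subsingleton (Ext L (I.cycles z) 1) :=
    (hz'.subsingleton_ext_iff L Nat.one_pos).2 h₁
  have := hI.injective z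
  have h₃ := injective_X₃_of_subsingleton_ext_one (shortExact_cycles hI.acyclic z)
    (subsingleton_ext_of_iso_left e h₂)
  exact Injective.of_iso e.symm h₃

variable (hC : IsZClusterTilting n C)
include hC

lemma IsZClusterTilting.mem_of_isSyzygy_mul [IsNoetherianRing A] :
    ∀ {i : ℕ} {X Y : ModuleCat.{u} A}, C X → IsSyzygy (i * n) X Y → C Y
  | 0, _, _, hX, h => by
    rw [zero_mul] at h
    exact hC.mem_of_iso h.some hX
  | i + 1, _, _, hX, h => by
    rw [add_mul, one_mul, add_comm] at h
    obtain ⟨K, h₁, h₂⟩ := h.exists_of_add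
    exact mem_of_isSyzygy_mul (hC.mem_of_isSyzygy hX h₁) h₂

lemma IsZClusterTilting.mem_of_isCosyzygy_mul :
    ∀ {i : ℕ} {X Y : ModuleCat.{u} A}, C X → IsCosyzygy (i * n) X Y → C Y
  | 0, _, _, hX, h => by
    rw [zero_mul] at h
    exact hC.mem_of_iso h.some hX
  | i + 1, _, _, hX, h => by
    rw [add_mul, one_mul, add_comm] at h
    obtain ⟨K, h₁, h₂⟩ := h.exists_of_add
    exact mem_of_isCosyzygy_mul (hC.mem_of_isCosyzygy hX h₁) h₂

/-- Towards negative indices the cycles are `n`-th syzygies. Towards positive ones, for `X` in `C`,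
`Ext^m(Z^{(i+1)n}, X)` vanishes with `Ext^{m+n}(Z^{(i+1)n}, Ω^n X)`, hence with `Ext^m(Z^{in}, Ω^n
X)`, which is zero for `0 < m < n`. -/
lemma IsZClusterTilting.cycles_mem_of_projAcyclic [IsNoetherianRing A]
    {K : CochainComplex (ModuleCat.{u} A) ℤ} (hK : K.Acyclic)
    (hfg : ∀ j, ModuleCat.isFG A (K.X j)) (hP : ∀ j, Projective (K.X j))
    (hG : ∀ j, ProjAcyclic (K.cycles j)) (h₀ : C (K.cycles 0)) (i : ℤ) : C (K.cycles (i * n)) := by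
  induction i using Int.induction_on with
  | zero => simpa using h₀
  | succ i ih =>
    rw [add_mul, one_mul]
    have h := isSyzygy_cycles hK hfg hP (i * n) n
    refine hC.mem_of_ext_left (isFG_X₁ (shortExact_cycles hK _) (hfg _)) fun X hX m hm hmn => ?_
    obtain ⟨Y, hY⟩ := exists_isSyzygy n (hC.isFG hX)
    rw [hY.subsingleton_ext_iff_of_projAcyclic (hG _) hm, ← h.subsingleton_ext_iff Y hm]
    exact hC.ext_eq_zero_of_lt ih (hC.mem_of_isSyzygy hX hY) hm hmn
  | pred i ih =>
    have h := isSyzygy_cycles hK hfg hP ((-i - 1) * n) n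
    rw [show (-(i : ℤ) - 1) * n + n = -i * n by ring] at h
    exact hC.mem_of_isSyzygy ih h

lemma IsZClusterTilting.cycles_mem_of_injAcyclic [IsNoetherianRing A]
    {K : CochainComplex (ModuleCat.{u} A) ℤ} (hK : K.Acyclic)
    (hfg : ∀ j, ModuleCat.isFG A (K.X j)) (hI : ∀ j, Injective (K.X j))
    (hG : ∀ j, InjAcyclic (K.cycles j))
    (hcosyz : ∀ X, ModuleCat.isFG A X → ∃ Y, IsCosyzygy n X Y)
    (h₀ : C (K.cycles 0)) (i : ℤ) : C (K.cycles (i * n)) := by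
  induction i using Int.induction_on with
  | zero => simpa using h₀
  | succ i ih =>
    rw [add_mul, one_mul]
    exact hC.mem_of_isCosyzygy ih (isCosyzygy_cycles hK hfg hI n (i * n))
  | pred i ih =>
    have h := isCosyzygy_cycles hK hfg hI n ((-i - 1) * n)
    rw [show (-(i : ℤ) - 1) * n + n = -i * n by ring] at h
    refine hC.mem_of_ext_right (isFG_X₁ (shortExact_cycles hK _) (hfg _)) fun X hX m hm hmn => ?_
    obtain ⟨Y, hY⟩ := hcosyz X (hC.isFG hX)
    rw [hY.subsingleton_ext_iff_of_injAcyclic (hG _) hm, ← h.subsingleton_ext_iff Y hm]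
    exact hC.ext_eq_zero_of_lt (hC.mem_of_isCosyzygy hX hY) ih hm hmn

end Cycles

/-! ### Approximations by powers of a fixed module. -/

section Approximation

variable {R : Type u} [CommRing R] {A : Type u} [Ring A] [Algebra R A]

variable (R) in
lemma exists_hom_generators [IsArtinianRing R] [Module.Finite R A] {X W : ModuleCat.{u} A} (hX : ModuleCat.isFG A X)
    (hW : ModuleCat.isFG A W) : ∃ (m : ℕ) (φ : Fin m → (X ⟶ W)), ∀ ψ : X ⟶ W,
      ∃ r : Fin m → R, ∀ x, ψ x = ∑ i, algebraMap R A (r i) • φ i x := by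
  let := Module.restrictScalars R A X
  let := Module.restrictScalars R A W
  have := IsScalarTower.restrictScalars R A X
  have := IsScalarTower.restrictScalars R A W
  have : Module.Finite A X := hX
  have : Module.Finite A W := hW
  have := Module.Finite.trans (R := R) A X
  have := Module.Finite.trans (R := R) A W
  have : IsNoetherian R (X →ₗ[A] W) :=
    isNoetherian_of_injective (LinearMap.restrictScalarsₗ R A X W R)
      (LinearMap.restrictScalars_injective R)
  obtain ⟨m, φ, hφ⟩ := Module.Finite.exists_fin (R := R) (M := X →ₗ[A] W)
  refine ⟨m, fun i => ModuleCat.ofHom (φ i), fun ψ => ?_⟩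
  have hψ : ψ.hom ∈ Submodule.span R (Set.range φ) := hφ ▸ Submodule.mem_top
  obtain ⟨r, hr⟩ := (Submodule.mem_span_range_iff_exists_fun R).1 hψ
  refine ⟨r, fun x => ?_⟩
  have := LinearMap.congr_fun hr x
  simp only [LinearMap.sum_apply, LinearMap.smul_apply] at this
  exact this.symm

/-- Multiplication by an element of the base ring, which is central. -/
def scalarEnd (r : R) (W : ModuleCat.{u} A) : W →ₗ[A] W where
  toFun w := algebraMap R A r • w
  map_add' x y := smul_add _ x y
  map_smul' a x := by
    rw [RingHom.id_apply, ← mul_smul, ← mul_smul, Algebra.commutes]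

/-- A left approximation of `X` by powers of `W`. -/
lemma exists_left_approximation (R : Type u) [CommRing R] [IsArtinianRing R]
    [Algebra R A] [Module.Finite R A] {X W : ModuleCat.{u} A}
    (hX : ModuleCat.isFG A X)
    (hW : ModuleCat.isFG A W) : ∃ (m : ℕ) (u : X ⟶ powObj W m), ∀ (k : ℕ) (ψ : X ⟶ powObj W k),
      ∃ h, u ≫ h = ψ := by
  obtain ⟨m, φ, hφ⟩ := exists_hom_generators R hX hW
  refine ⟨m, ModuleCat.ofHom (LinearMap.pi fun i => (φ i).hom), fun k ψ => ?_⟩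
  choose r hr using fun j => hφ (ψ ≫ ModuleCat.ofHom (LinearMap.proj j))
  -- Each component of `ψ` is an `R`-combination of the generators `φ i`; its coefficients act on
  -- `W` by `A`-linear endomorphisms, so they form a matrix through which `ψ` factors.
  refine ⟨ModuleCat.ofHom (LinearMap.pi fun j =>
    ∑ i, scalarEnd (r j i) W ∘ₗ LinearMap.proj i), ModuleCat.hom_ext <| LinearMap.ext fun x => ?_⟩
  funext j
  refine Eq.trans ?_ (hr j x).symm
  change (∑ i, scalarEnd (r j i) W ∘ₗ LinearMap.proj i : (Fin m → W) →ₗ[A] W)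
    (fun i => φ i x) = _
  simp only [LinearMap.sum_apply]
  rfl

/-- A right approximation of `X` by powers of `W`. -/
lemma exists_right_approximation (R : Type u) [CommRing R] [IsArtinianRing R]
    [Algebra R A] [Module.Finite R A] {X W : ModuleCat.{u} A}
    (hX : ModuleCat.isFG A X)
    (hW : ModuleCat.isFG A W) : ∃ (m : ℕ) (v : powObj W m ⟶ X), ∀ (k : ℕ) (ψ : powObj W k ⟶ X),
      ∃ h, h ≫ v = ψ := by
  classical
  obtain ⟨m, φ, hφ⟩ := exists_hom_generators R hW hX
  refine ⟨m, ModuleCat.ofHom (∑ i, (φ i).hom ∘ₗ LinearMap.proj i), fun k ψ => ?_⟩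
  choose r hr using fun j => hφ (ModuleCat.ofHom (LinearMap.single A (fun _ => W) j) ≫ ψ)
  refine ⟨ModuleCat.ofHom (LinearMap.pi fun i =>
    ∑ j, scalarEnd (r j i) W ∘ₗ LinearMap.proj j), ModuleCat.hom_ext ?_⟩
  refine LinearMap.pi_ext' fun j => LinearMap.ext fun w => ?_
  refine Eq.trans ?_ (hr j w).symm
  change (∑ i, (φ i).hom ∘ₗ LinearMap.proj i : (Fin m → W) →ₗ[A] X)
    (fun i => (∑ j, scalarEnd (r j i) W ∘ₗ LinearMap.proj j : (Fin k → W) →ₗ[A] W)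
      (Pi.single j w)) = _
  simp only [LinearMap.sum_apply, LinearMap.comp_apply, LinearMap.proj_apply]
  refine Finset.sum_congr rfl fun i _ => ?_
  rw [Finset.sum_eq_single j]
  · rw [Pi.single_eq_same]
    exact (φ i).hom.map_smul _ _
  · intro j' _ hj
    rw [Pi.single_eq_of_ne hj, map_zero]
  · simp

end Approximation

/-! ### Propagating Ext vanishing along complete resolutions. -/

section Resolution

variable {A : Type u} [Ring A]

/-- Shifting along a finite projective resolution of `Y` ends at Ext into a projective module. -/
lemma subsingleton_ext_of_projAcyclic [IsNoetherianRing A] {X Y : ModuleCat.{u} A}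
    (hX : ProjAcyclic X) (hY : ModuleCat.isFG A Y) {d : ℕ}
    (hd : HasProjectiveDimensionLT Y (d + 1)) {m : ℕ} (hm : 0 < m) :
    Subsingleton (Ext X Y m) := by
  obtain ⟨L, hL⟩ := exists_isSyzygy d hY
  exact (hL.subsingleton_ext_iff_of_projAcyclic hX hm).2
    (hX L (hL.isFG hY) (hL.projective hd) _ (by omega))

lemma projAcyclic_X₁ {S : ShortComplex (ModuleCat.{u} A)} (hS : S.ShortExact)
    [Projective S.X₂] (h : ProjAcyclic S.X₃) : ProjAcyclic S.X₁ := fun Q hQ hQ' _ hm =>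
  subsingleton_ext_X₁ hS (subsingleton_ext_of_projective Q hm) (h Q hQ hQ' _ (Nat.succ_pos _))

lemma injAcyclic_X₃ {S : ShortComplex (ModuleCat.{u} A)} (hS : S.ShortExact)
    [Injective S.X₂] (h : InjAcyclic S.X₁) : InjAcyclic S.X₃ := fun J hJ hJ' _ hm =>
  subsingleton_ext_X₃ hS (subsingleton_ext_of_injective J hm) (h J hJ hJ' _ (Nat.succ_pos _))

lemma projAcyclic_X₃ {S : ShortComplex (ModuleCat.{u} A)} (hS : S.ShortExact)
    [Projective S.X₂] (h : ProjAcyclic S.X₁)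
    (hext : ∀ Q : ModuleCat.{u} A, ModuleCat.isFG A Q → Projective Q →
      ∀ f : S.X₁ ⟶ Q, ∃ g : S.X₂ ⟶ Q, S.f ≫ g = f) : ProjAcyclic S.X₃ := by
  rintro Q hQ hQ' (_ | _ | m) hm
  · exact absurd hm (lt_irrefl 0)
  · exact subsingleton_ext_one_of_exists_extension hS (subsingleton_ext_of_projective Q hm)
      (hext Q hQ hQ')
  · exact subsingleton_ext_succ_X₃ hS (h Q hQ hQ' _ m.succ_pos)
      (subsingleton_ext_of_projective Q hm)

lemma injAcyclic_X₁ {S : ShortComplex (ModuleCat.{u} A)} (hS : S.ShortExact)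
    [Injective S.X₂] (h : InjAcyclic S.X₃)
    (hlift : ∀ J : ModuleCat.{u} A, ModuleCat.isFG A J → Injective J →
      ∀ f : J ⟶ S.X₃, ∃ g : J ⟶ S.X₂, g ≫ S.g = f) : InjAcyclic S.X₁ := by
  rintro J hJ hJ' (_ | _ | m) hm
  · exact absurd hm (lt_irrefl 0)
  · exact subsingleton_ext_one_of_exists_lift hS (subsingleton_ext_of_injective J hm)
      (hlift J hJ hJ')
  · exact subsingleton_ext_succ_X₁ hS (h J hJ hJ' _ m.succ_pos)
      (subsingleton_ext_of_injective J hm)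

/-- `X` is the kernel and `Y` the cokernel in a short exact sequence with middle term in `𝒬`. -/
def IsSyzygyStep (𝒬 : ObjectProperty (ModuleCat.{u} A)) (X Y : ModuleCat.{u} A) : Prop :=
  ∃ (P : ModuleCat.{u} A) (f : X ⟶ P) (g : P ⟶ Y) (w : f ≫ g = 0),
    (ShortComplex.mk f g w).ShortExact ∧ 𝒬 P

lemma exists_acyclic_of_isSyzygyStep (𝒬 𝒢 : ObjectProperty (ModuleCat.{u} A))
    (up : ∀ X, 𝒢 X → ∃ Y, 𝒢 Y ∧ IsSyzygyStep 𝒬 X Y)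
    (down : ∀ X, 𝒢 X → ∃ Y, 𝒢 Y ∧ IsSyzygyStep 𝒬 Y X) {L : ModuleCat.{u} A} (hL : 𝒢 L) :
    ∃ K : CochainComplex (ModuleCat.{u} A) ℤ, K.Acyclic ∧ (∀ j, 𝒬 (K.X j)) ∧
      Nonempty (L ≅ K.cycles 0) ∧ ∀ j, ∃ Z, 𝒢 Z ∧ Nonempty (Z ≅ K.cycles j) := by
  obtain ⟨Z, hZ₀, hZ⟩ := exists_int_family (IsSyzygyStep 𝒬) 𝒢 up down L hL
  choose P f g w hS hP using fun k => (hZ k).2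
  obtain ⟨K, hK, hKX, hKZ⟩ := exists_acyclic_of_shortExact Z P f g w hS
  exact ⟨K, hK, fun j => by rw [hKX j]; exact hP j, ⟨eqToIso hZ₀.symm ≪≫ (hKZ 0).some.symm⟩,
    fun j => ⟨Z j, (hZ j).1, ⟨(hKZ j).some.symm⟩⟩⟩

lemma ProjAcyclic.of_iso {X Y : ModuleCat.{u} A} (e : X ≅ Y) (h : ProjAcyclic X) :
    ProjAcyclic Y := fun Q hQ hQ' m hm => subsingleton_ext_of_iso_left e (h Q hQ hQ' m hm)

lemma InjAcyclic.of_iso {X Y : ModuleCat.{u} A} (e : X ≅ Y) (h : InjAcyclic X) :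
    InjAcyclic Y := fun J hJ hJ' m hm => subsingleton_ext_of_iso_right e (h J hJ hJ' m hm)

end Resolution

/-! ### Complete resolutions over an Iwanaga–Gorenstein algebra. -/

section Gorenstein

variable {R : Type u} [CommRing R] [IsArtinianRing R] {A B : Type u} [Ring A] [Ring B]
  [Algebra R A] [Algebra R B] [Module.Finite R A] [Module.Finite R B] [IsNoetherianRing A]
  {E : Type u} [AddCommGroup E] [Module R E]

lemma isFG_self {A : Type u} [Ring A] : ModuleCat.isFG A (ModuleCat.of A A) := Module.Finite.self A

/-- Embed `X` in an injective `I` and cover `I` by a projective `P`. The kernel `K` has finite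
projective dimension, so `Ext^1(X, K) = 0` and the embedding lifts to `P`. The lift factors through
the left approximation `u` by free modules, forcing `u` to be monic; the approximation property
supplies the `Ext^1` vanishing for its cokernel. -/
lemma exists_projAcyclic_cokernel (σ : B ≃ₐ[R] Aᵐᵒᵖ) (hE : IsDualizing R E) {d : ℕ}
    (hd : ∀ J : ModuleCat.{u} A, ModuleCat.isFG A J → Injective J →
      HasProjectiveDimensionLT J (d + 1))
    {X : ModuleCat.{u} A} (hX : ModuleCat.isFG A X) (hX' : ProjAcyclic X) :
    ∃ Y, (ModuleCat.isFG A Y ∧ ProjAcyclic Y) ∧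
      IsSyzygyStep (fun P => ModuleCat.isFG A P ∧ Projective P) X Y := by
  obtain ⟨I, _, i, _, _, hSI, hI, hI'⟩ := exists_injective_presentation σ hE hX
  obtain ⟨K, P, f, g, w, hS, hP, hP'⟩ := exists_projective_presentation hI
  have := hd I hI hI'
  have hK : HasProjectiveDimensionLT K (d + 1) :=
    hS.hasProjectiveDimensionLT_X₁ (d + 1) (hasProjectiveDimensionLT_of_ge P 1 _ (by omega))
      (hasProjectiveDimensionLT_of_ge I (d + 1) _ (by omega))
  obtain ⟨l, hl⟩ := exists_lift_of_subsingleton_ext_one hS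
    (subsingleton_ext_of_projAcyclic hX' (isFG_X₁ hS hP) hK Nat.one_pos) i
  obtain ⟨m, u, hu⟩ := exists_left_approximation R hX (isFG_self (A := A))
  have hext (Q : ModuleCat.{u} A) (hQ : ModuleCat.isFG A Q) (hQ' : Projective Q) (ψ : X ⟶ Q) :
      ∃ h, u ≫ h = ψ := by
    obtain ⟨k, ⟨r⟩⟩ := exists_retract_powObj hQ
    obtain ⟨h, hh⟩ := hu k (ψ ≫ r.i)
    exact ⟨h ≫ r.r, by rw [reassoc_of% hh, r.retract, Category.comp_id]⟩
  obtain ⟨l', rfl⟩ := hext P hP hP' l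
  have hmono : Mono u := by
    have : Mono (u ≫ l' ≫ g) := by
      have := hSI.mono_f
      rw [← Category.assoc, hl]
      exact this
    exact mono_of_mono u (l' ≫ g)
  let S := ShortComplex.mk u (Limits.cokernel.π u) (Limits.cokernel.condition u)
  have hS' : S.ShortExact := { exact := ShortComplex.exact_cokernel u }
  have hproj : Projective S.X₂ := ModuleCat.projective_of_free (Pi.basisFun A (Fin m))
  exact ⟨S.X₃, ⟨isFG_X₃ hS' (isFG_powObj isFG_self m), projAcyclic_X₃ hS' hX' hext⟩,
    S.X₂, S.f, S.g, S.zero, hS', isFG_powObj isFG_self m, hproj⟩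

/-- Dually, a projective cover map `P → X` extends to an injective `I ⊇ P`, since `I / P` has finite
injective dimension and `Ext^1(I / P, X) = 0`. The right approximation by powers of the cogenerator
is therefore epic. -/
lemma exists_injAcyclic_kernel (σ : B ≃ₐ[R] Aᵐᵒᵖ) (hE : IsDualizing R E) {d : ℕ}
    (hd : ∀ Q : ModuleCat.{u} A, ModuleCat.isFG A Q → Projective Q →
      HasInjectiveDimensionLT Q (d + 1))
    {X : ModuleCat.{u} A} (hX : ModuleCat.isFG A X) (hX' : InjAcyclic X) :
    ∃ Y, (ModuleCat.isFG A Y ∧ InjAcyclic Y) ∧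
      IsSyzygyStep (fun I => ModuleCat.isFG A I ∧ Injective I) Y X := by
  obtain ⟨_, P, _, p, _, hSP, hP, hP'⟩ := exists_projective_presentation hX
  obtain ⟨I, K, f, g, w, hS, hI, hI'⟩ := exists_injective_presentation σ hE hP
  have := hd P hP hP'
  have hK : HasInjectiveDimensionLT K (d + 1) :=
    hS.hasInjectiveDimensionLT_X₃ (d + 1) (hasInjectiveDimensionLT_of_ge I 1 _ (by omega))
      (hasInjectiveDimensionLT_of_ge P (d + 1) _ (by omega))
  obtain ⟨N, hN⟩ := exists_isCosyzygy σ hE d (isFG_X₃ hS hI)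
  have hext : Subsingleton (Ext K X 1) :=
    (hN.subsingleton_ext_iff_of_injAcyclic hX' Nat.one_pos).2
      (hX' N (hN.isFG (isFG_X₃ hS hI)) (hN.injective hK) _ (by omega))
  obtain ⟨l, hl⟩ := exists_extension_of_subsingleton_ext_one hS hext p
  obtain ⟨m, v, hv⟩ := exists_right_approximation R hX (isFG_cogenerator σ hE)
  have hlift (J : ModuleCat.{u} A) (hJ : ModuleCat.isFG A J) (hJ' : Injective J) (ψ : J ⟶ X) :
      ∃ h, h ≫ v = ψ := by
    obtain ⟨k, ⟨r⟩⟩ := exists_retract_powObj_cogenerator σ hE hJ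
    obtain ⟨h, hh⟩ := hv k (r.r ≫ ψ)
    exact ⟨r.i ≫ h, by rw [Category.assoc, hh, r.retract_assoc]⟩
  obtain ⟨l', rfl⟩ := hlift I hI hI' l
  have hepi : Epi v := by
    have : Epi ((f ≫ l') ≫ v) := by
      have := hSP.epi_g
      rw [Category.assoc, hl]
      exact this
    exact epi_of_epi (f ≫ l') v
  let S := ShortComplex.mk (Limits.kernel.ι v) v (Limits.kernel.condition v)
  have hS' : S.ShortExact := { exact := ShortComplex.exact_kernel v }
  have hinj : Injective S.X₂ := injective_powObj (injective_cogenerator σ hE) m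
  have hfg : ModuleCat.isFG A S.X₂ := isFG_powObj (isFG_cogenerator σ hE) m
  exact ⟨S.X₁, ⟨isFG_X₁ hS' hfg, injAcyclic_X₁ hS' hX' hlift⟩,
    S.X₂, S.f, S.g, S.zero, hS', hfg, hinj⟩

variable {n : ℕ} {C : ObjectProperty (ModuleCat.{u} A)}

lemma isZGorensteinProjective_of_projAcyclic (σ : B ≃ₐ[R] Aᵐᵒᵖ) (hE : IsDualizing R E) {d : ℕ}
    (hd : ∀ J : ModuleCat.{u} A, ModuleCat.isFG A J → Injective J →
      HasProjectiveDimensionLT J (d + 1))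
    (hC : IsZClusterTilting n C) {L : ModuleCat.{u} A} (hL : C L) (hL' : ProjAcyclic L) :
    IsZGorensteinProjective n C L := by
  obtain ⟨K, hK, hKP, ⟨e⟩, hKG⟩ := exists_acyclic_of_isSyzygyStep
    (fun P => ModuleCat.isFG A P ∧ Projective P) (fun X => ModuleCat.isFG A X ∧ ProjAcyclic X)
    (fun X hX => exists_projAcyclic_cokernel σ hE hd hX.1 hX.2)
    (fun X hX => by
      obtain ⟨Y, P, f, g, w, hS, hP, hP'⟩ := exists_projective_presentation hX.1
      exact ⟨Y, ⟨isFG_X₁ hS hP, projAcyclic_X₁ hS hX.2⟩, P, f, g, w, hS, hP, hP'⟩)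
    ⟨hC.isFG hL, hL'⟩
  have hKG' (j : ℤ) : ProjAcyclic (K.cycles j) :=
    let ⟨_, hZ, ⟨e⟩⟩ := hKG j
    hZ.2.of_iso e
  refine ⟨hL, K, 0, ?_, ⟨e ≪≫ eqToIso (by simp)⟩⟩
  exact
    { acyclic := hK
      fg := fun j => (hKP j).1
      projective := fun j => (hKP j).2
      hom_acyclic := fun Q hQ hQ' i => homFromSegmentAcyclic_of_extension hK
        (fun j => exists_extension_of_subsingleton_ext_one (shortExact_cycles hK j)
          (hKG' (j + 1) Q hQ hQ' 1 Nat.one_pos)) _ _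
      cycles_mem := hC.cycles_mem_of_projAcyclic hK (fun j => (hKP j).1) (fun j => (hKP j).2)
        hKG' (hC.mem_of_iso e hL) }

lemma isZGorensteinInjective_of_injAcyclic (σ : B ≃ₐ[R] Aᵐᵒᵖ) (hE : IsDualizing R E) {d : ℕ}
    (hd : ∀ Q : ModuleCat.{u} A, ModuleCat.isFG A Q → Projective Q →
      HasInjectiveDimensionLT Q (d + 1))
    (hC : IsZClusterTilting n C) {L : ModuleCat.{u} A} (hL : C L) (hL' : InjAcyclic L) :
    IsZGorensteinInjective n C L := by
  obtain ⟨K, hK, hKI, ⟨e⟩, hKG⟩ := exists_acyclic_of_isSyzygyStep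
    (fun I => ModuleCat.isFG A I ∧ Injective I) (fun X => ModuleCat.isFG A X ∧ InjAcyclic X)
    (fun X hX => by
      obtain ⟨I, Y, f, g, w, hS, hI, hI'⟩ := exists_injective_presentation σ hE hX.1
      exact ⟨Y, ⟨isFG_X₃ hS hI, injAcyclic_X₃ hS hX.2⟩, I, f, g, w, hS, hI, hI'⟩)
    (fun X hX => exists_injAcyclic_kernel σ hE hd hX.1 hX.2)
    ⟨hC.isFG hL, hL'⟩
  have hKG' (j : ℤ) : InjAcyclic (K.cycles j) :=
    let ⟨_, hZ, ⟨e⟩⟩ := hKG j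
    hZ.2.of_iso e
  refine ⟨hL, K, 0, ?_, ⟨e ≪≫ eqToIso (by simp)⟩⟩
  exact
    { acyclic := hK
      fg := fun j => (hKI j).1
      injective := fun j => (hKI j).2
      hom_acyclic := fun J hJ hJ' i => homToSegmentAcyclic_of_lift hK
        (fun j => exists_lift_of_subsingleton_ext_one (shortExact_cycles hK j)
          (hKG' j J hJ hJ' 1 Nat.one_pos)) _ _
      cycles_mem := hC.cycles_mem_of_injAcyclic hK (fun j => (hKI j).1) (fun j => (hKI j).2)
        hKG' (fun _ hX => exists_isCosyzygy σ hE n hX) (hC.mem_of_iso e hL) }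

lemma isZGprjClusterTilting_of_gorenstein (σ : B ≃ₐ[R] Aᵐᵒᵖ) (hE : IsDualizing R E) (hn : 0 < n)
    (hC : IsZClusterTilting n C) {d : ℕ}
    (hA : HasInjectiveDimensionLT (ModuleCat.of A A) (d + 1))
    (hB : HasInjectiveDimensionLT (ModuleCat.of B B) (d + 1)) : IsZGprjClusterTilting n C := by
  intro M hM
  obtain ⟨L, hL⟩ := exists_isSyzygy (d * n) (hC.isFG hM)
  refine ⟨d, L, hL, isZGorensteinProjective_of_projAcyclic σ hE
    (fun J hJ _ => hasProjectiveDimensionLT_of_injective σ hE hB hJ) hC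
    (hC.mem_of_isSyzygy_mul hM hL) fun Q hQ hQ' m hm => ?_⟩
  rw [hL.subsingleton_ext_iff Q hm]
  -- The degree is now `m + d * n`, at least `d + 1` since `m` and `n` are positive.
  have := hasInjectiveDimensionLT_of_projective hA hQ
  exact HasInjectiveDimensionLT.subsingleton Q (d + 1) _
    (by have := Nat.le_mul_of_pos_right d hn; omega) M

lemma isZGinjClusterTilting_of_gorenstein (σ : B ≃ₐ[R] Aᵐᵒᵖ) (hE : IsDualizing R E) (hn : 0 < n)
    (hC : IsZClusterTilting n C) {d : ℕ}
    (hA : HasInjectiveDimensionLT (ModuleCat.of A A) (d + 1))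
    (hB : HasInjectiveDimensionLT (ModuleCat.of B B) (d + 1)) : IsZGinjClusterTilting n C := by
  intro M hM
  obtain ⟨L, hL⟩ := exists_isCosyzygy σ hE (d * n) (hC.isFG hM)
  refine ⟨d, L, hL, isZGorensteinInjective_of_injAcyclic σ hE
    (fun Q hQ _ => hasInjectiveDimensionLT_of_projective hA hQ) hC
    (hC.mem_of_isCosyzygy_mul hM hL) fun J hJ hJ' m hm => ?_⟩
  rw [hL.subsingleton_ext_iff J hm]
  have := hasProjectiveDimensionLT_of_injective σ hE hB hJ
  exact HasProjectiveDimensionLT.subsingleton J (d + 1) _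
    (by have := Nat.le_mul_of_pos_right d hn; omega) M

end Gorenstein

/-! ### From the Gorenstein conditions to finite injective dimension, and the theorem. -/

lemma exists_hasInjectiveDimensionLT_of_isZGinj {A : Type u} [Ring A] {n : ℕ}
    {C : ObjectProperty (ModuleCat.{u} A)} (hn : 0 < n) (hC : IsZClusterTilting n C)
    (h : IsZGinjClusterTilting n C) : ∃ d, HasInjectiveDimensionLT (ModuleCat.of A A) d := by
  have : Projective (ModuleCat.of A A) := (IsProjective.iff_projective A).1 inferInstance
  obtain ⟨i, L, hL, hL'⟩ := h _ (hC.mem_of_projective (isFG_self (A := A)))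
  exact ⟨_, hL.hasInjectiveDimensionLT (hL'.injective_of_isCosyzygy hn hL)⟩

/-- The condition is applied to the cogenerator: its Gorenstein projective syzygy is projective, and
dualizing the finite resolution bounds the injective dimension of `B`. -/
lemma exists_hasInjectiveDimensionLT_of_isZGprj {R : Type u} [CommRing R]
    [IsArtinianRing R] {A B : Type u} [Ring A] [Ring B] [Algebra R A] [Algebra R B]
    [Module.Finite R B] {E : Type u} [AddCommGroup E] [Module R E] {n : ℕ}
    {C : ObjectProperty (ModuleCat.{u} A)} (σ : B ≃ₐ[R] Aᵐᵒᵖ) (hE : IsDualizing R E)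
    (hn : 0 < n) (hC : IsZClusterTilting n C) (h : IsZGprjClusterTilting n C) :
    ∃ d, HasInjectiveDimensionLT (ModuleCat.of B B) d := by
  have := injective_cogenerator σ hE
  obtain ⟨i, L, hL, hL'⟩ := h _ (hC.mem_of_injective (isFG_cogenerator σ hE))
  have := hL.hasInjectiveDimensionLT_dualObj σ hE.injective (hL'.projective_of_isSyzygy hn hL)
  exact ⟨_, hasInjectiveDimensionLT_of_iso (dualCogeneratorIso σ hE).symm (i * n + 1)⟩

lemma injectiveDimension_lt_top_iff {A : Type u} [Ring A] (X : ModuleCat.{u} A) :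
    injectiveDimension X < ⊤ ↔ ∃ d, HasInjectiveDimensionLT X d := by
  rw [lt_top_iff_ne_top, injectiveDimension_ne_top_iff]
  exact ⟨fun ⟨d, hd⟩ => ⟨d + 1, hd⟩, fun ⟨d, _⟩ =>
    ⟨d, hasInjectiveDimensionLT_of_ge X d _ (by omega)⟩⟩

/-- The regular right module of `Λ` is the regular module of the opposite ring. -/
def opRegularIso (Λ : Type u) [Ring Λ] :
    ModuleCat.of Λᵐᵒᵖ Λᵐᵒᵖ ≅ ModuleCat.of Λᵐᵒᵖ Λ :=
  LinearEquiv.toModuleIso (MulOpposite.opLinearEquiv Λᵐᵒᵖ).symm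

lemma isZGorensteinClusterTilting_iff {R Λ : Type u} [CommRing R] [IsArtinianRing R] [Ring Λ]
    [Algebra R Λ] [Module.Finite R Λ] {n : ℕ} (hn : 0 < n)
    {C : ObjectProperty (ModuleCat.{u} Λᵐᵒᵖ)} (hC : IsZClusterTilting n C) :
    IsZGorensteinClusterTilting n C ↔ IsIwanagaGorenstein Λ := by
  obtain ⟨E, _, _, h₁, h₂, h₃⟩ := exists_dualizing_module R
  have hE : IsDualizing R E := ⟨h₁, h₂, h₃⟩
  have : Module.Finite R Λᵐᵒᵖ := Module.Finite.equiv (MulOpposite.opLinearEquiv R)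
  have : IsNoetherianRing Λᵐᵒᵖ := isNoetherian_of_tower R inferInstance
  let σ : Λ ≃ₐ[R] Λᵐᵒᵖᵐᵒᵖ := AlgEquiv.opOp R Λ
  constructor
  · intro h
    obtain ⟨d, hd⟩ := exists_hasInjectiveDimensionLT_of_isZGinj hn hC h.ginj
    exact ⟨(injectiveDimension_lt_top_iff _).2
        ⟨d, hasInjectiveDimensionLT_of_iso (opRegularIso Λ) d⟩,
      (injectiveDimension_lt_top_iff _).2
        (exists_hasInjectiveDimensionLT_of_isZGprj σ hE hn hC h.gprj)⟩
  · intro h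
    obtain ⟨a, ha⟩ := (injectiveDimension_lt_top_iff _).1 h.right
    obtain ⟨b, hb⟩ := (injectiveDimension_lt_top_iff _).1 h.left
    -- One common bound `d = max a b` serves both regular modules.
    have hA : HasInjectiveDimensionLT (ModuleCat.of Λᵐᵒᵖ Λᵐᵒᵖ) (max a b + 1) := by
      have := hasInjectiveDimensionLT_of_iso (opRegularIso Λ).symm a
      exact hasInjectiveDimensionLT_of_ge _ a _ (by omega)
    have hB : HasInjectiveDimensionLT (ModuleCat.of Λ Λ) (max a b + 1) :=
      hasInjectiveDimensionLT_of_ge _ b _ (by omega)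
    exact
      { toIsZClusterTilting := hC
        gprj := isZGprjClusterTilting_of_gorenstein σ hE hn hC hA hB
        ginj := isZGinjClusterTilting_of_gorenstein σ hE hn hC hA hB }

end GorensteinCT

theorem theorem3p10 {R : Type*} {Λ : Type u} [CommRing R] [IsArtinianRing R] [Ring Λ]
    [Algebra R Λ] [Module.Finite R Λ] (n : ℕ) (hn : 0 < n)
    (C : ObjectProperty (ModuleCat.{u} Λᵐᵒᵖ)) (hC : GorensteinCT.IsZClusterTilting n C) :
    GorensteinCT.IsZGorensteinClusterTilting n C ↔ GorensteinCT.IsIwanagaGorenstein Λ := by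
  -- `R` may live in another universe than `Λ`. It is replaced by its image in `Λ`, a central
  -- subring that is again artinian and over which `Λ` is still finite.
  let S : Subalgebra R Λ := ⊥
  have hcomm (s : S) (x : Λ) : (s : Λ) * x = x * s := by
    obtain ⟨r, hr⟩ := Algebra.mem_bot.1 s.2
    rw [← hr, Algebra.commutes]
  let : CommRing S := { S.toRing with mul_comm := fun s t => Subtype.ext (hcomm s t) }
  let : Algebra S Λ := RingHom.toAlgebra' S.val.toRingHom hcomm
  have : IsArtinianRing S :=
    (Function.Surjective.isArtinianRing (f := algebraMap R S) fun x => by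
      obtain ⟨r, hr⟩ := Algebra.mem_bot.1 x.2
      exact ⟨r, Subtype.ext hr⟩)
  have : Module.Finite S Λ := Module.Finite.of_restrictScalars_finite R S Λ
  have : @Module.Finite S Λ _ _ Algebra.toModule := this
  exact GorensteinCT.isZGorensteinClusterTilting_iff (R := S) hn hC
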